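/- Throughout, a Lie groupoid $\mathsf G=(G^1\rightrightarrows G^0)$ has smooth manifolds (finite-dimensional, Hausdorff, second countable) of objects and arrows, smooth structure maps and submersive source and target; arrows are composed from left to right. A strict morphism is a smooth functor. A strict morphism $\psi:\mathsf U\to\mathsf H$ is an equivalence if $t\circ pr_2:U^0\times_{\psi^0,s}H^1\to H^0$ is a surjective submersion and $U^1$ is the fiber product of $\psi^0\times\psi^0:U^0\times U^0\to H^0\times H^0$ and $s\times t:H^1\to H^0\times H^0$. Let $\mathsf A,\mathsf K$ be groupoids. A generalized cocycle of $\mathsf K$ with values in $\mathsf A$ is a pair $(\Lambda,\Omega)$ consisting of strict automorphisms $\Lambda_\xi$ of $\mathsf A$ for $\xi\in K^1$, with $\Lambda_{1_x}=\mathrm{id}$, and natural transformations $\Omega(\xi,\eta,\cdot):\mathrm{id}_{\mathsf A}\Rightarrow\Lambda_{\xi\eta}^{-1}\Lambda_\eta\Lambda_\xi$ for composable $\xi,\eta$, with $\Omega(1_{s(\eta)},\eta,a)=1_a=\Omega(\xi,1_{t(\xi)},a)$ and, for composable $\xi,\eta,\zeta$ and $a\in A^0$, $$\Omega(\xi,\eta,a)\cdot\Omega(\xi\eta,\zeta,\Lambda_{\xi\eta}^{-1}\Lambda_\eta\Lambda_\xi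 a)=\Lambda_\xi^{-1}\big(\Omega(\eta,\zeta,\Lambda_\xi a)\big)\cdot\Omega(\xi,\eta\zeta,\Lambda_\xi^{-1}\Lambda_{\eta\zeta}^{-1}\Lambda_\zeta\Lambda_\eta\Lambda_\xi a).$$ If $\mathsf A,\mathsf K$ are Lie groupoids, it is moreover required that the $\Lambda_\xi$ and $\Lambda_\xi^{-1}$ are smooth and that $(\xi,a)\mapsto\Lambda_\xi(a)$, $(\xi,\alpha)\mapsto\Lambda_\xi(\alpha)$ and $\Omega:K^{[2]}\times A^0\to A^1$ are smooth, where $K^{[2]}$ is the set of composable pairs. Let $\mathsf A\rtimes_{\Lambda,\Omega}\mathsf K=(A^1\times K^1\rightrightarrows A^0\times K^0)$ have the structure maps $s(\alpha,\xi)=(s(\alpha),s(\xi))$, $t(\alpha,\xi)=(\Lambda_\xi(t(\alpha)),t(\xi))$, unit $(1_a,1_x)$ at $(a,x)$, $$(\alpha,\xi)(\beta,\eta)=\big(\Omega(\xi,\eta,s(\alpha))\cdot\Lambda_{\xi\eta}^{-1}\Lambda_\eta\Lambda_\xi(\alpha)\cdot\Lambda_{\xi\eta}^{-1}\Lambda_\eta(\beta),\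 \xi\eta\big),$$ $$(\alpha,\xi)^{-1}=\big(\Lambda_\xi(\alpha^{-1})\cdot\Lambda_{\xi^{-1}}^{-1}(\Omega(\xi,\xi^{-1},s(\alpha))^{-1}),\ \xi^{-1}\big).$$ It is called an extension of $\mathsf K$ by $\mathsf A$ with pre-action map $\Lambda$ and cofactor $\Omega$ if it is a groupoid, the second projection is a functor to $\mathsf K$ whose kernel over every $x\in K^0$ is $\mathsf A$, and $(1_{s(\alpha)},\xi)^{-1}(\alpha,1_{s(\xi)})(1_{t(\alpha)},\xi)=(\Lambda_\xi(\alpha),1_{t(\xi)})$ and $(1_a,\xi)(1_{\Lambda_\xi a},\eta)(1_{a'},\xi\eta)^{-1}=(\Omega(\xi,\eta,a),1_{s(\xi)})$ with $a'=\Lambda_{\xi\eta}^{-1}\Lambda_\eta\Lambda_\xi a$. For Lie groupoids $\mathsf H,\mathsf A$, the objects of the groupoid $\mathsf{Mor}(\mathsf H,\mathsf A)$ are the generalized morphisms $(\mathsf U,\psi,u)$, that is, Lie groupoids $\mathsf U$ with an equivalence $\psi:\mathsf U\to\mathsf H$ and a strict morphism $u:\mathsf U\to\mathsf A$. The arrows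 $(\mathsf U_1,\psi_1,u_1)\to(\mathsf U_2,\psi_2,u_2)$ are the (smooth) natural transformations $\alpha:u_1\pi_1\Rightarrow u_2\pi_2$ on the fiber product $\mathsf U_1\times_{\mathsf H}\mathsf U_2$, whose objects are the triples $(a_1,h,a_2)$ with $h:\psi_1(a_1)\to\psi_2(a_2)$ in $\mathsf H$; composition is $(\alpha\bullet\beta)(a_1,hk,a_3)=\alpha(a_1,h,a_2)\cdot\beta(a_2,k,a_3)$. **Theorem.** Let $\mathsf H,\mathsf A,\mathsf K$ be Lie groupoids and let $(\Lambda,\Omega)$ be a generalized cocycle of $\mathsf K$ with values in $\mathsf A$ (as Lie groupoids). 1. There are automorphisms $\tilde\Lambda_\xi$ of $\mathsf{Mor}(\mathsf H,\mathsf A)$, $\xi\in K^1$, given by $(\mathsf U,\psi,u)\mapsto(\mathsf U,\psi,\Lambda_\xi\circ u)$ and $\alpha\mapsto\Lambda_\xi\circ\alpha$, and, for composable $\xi,\eta$ and every object $o=(\mathsf U,\psi,u)$, an arrow $\tilde\Omega(\xi,\eta,o)$ from $o$ to $(\mathsf U,\psi,\Lambda_{\xi\eta}^{-1}\Lambda_\eta\Lambda_\xi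 u)$ given by $$(a_1,h,a_2)\longmapsto u(g)\cdot\Omega(\xi,\eta,u(a_2))=\Omega(\xi,\eta,u(a_1))\cdot\Lambda_{\xi\eta}^{-1}\Lambda_\eta\Lambda_\xi(u(g)),$$ where $g:a_1\to a_2$ is the arrow of $\mathsf U$ with $\psi(g)=h$. The pair $(\tilde\Lambda,\tilde\Omega)$ is a generalized cocycle of $\mathsf K$ with values in the groupoid $\mathsf{Mor}(\mathsf H,\mathsf A)$, and $\mathsf{Mor}(\mathsf H,\mathsf A)\rtimes_{\tilde\Lambda,\tilde\Omega}\mathsf K$ is an extension of $\mathsf K$ by $\mathsf{Mor}(\mathsf H,\mathsf A)$ with pre-action map $\tilde\Lambda$ and cofactor $\tilde\Omega$. 2. Write $\overline{\mathsf G}$ for the coarse space $G^0/G^1$, and put $\mathsf G=\mathsf A\rtimes_{\Lambda,\Omega}\mathsf K$. Let $[\overline{\mathsf H}]\in H_n(\overline{\mathsf H},\mathbb Z)$ be the fundamental class of $\overline{\mathsf H}$, if it exists (the statement holds for every class in place of $[\overline{\mathsf H}]$), and let $\beta\in H_n(\overline{\mathsf G},\mathbb Z)$. For $x\in K^0$ let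 $\iota_x:\overline{\mathsf A}\to\overline{\mathsf G}$ be induced by $a\mapsto(a,x)$. Suppose that the set of classes $c\in H_n(\overline{\mathsf A},\mathbb Z)$ with $(\iota_x)_*c=\beta$ does not depend on $x\in K^0$. (In particular, one may suppose that this set consists of one and the same class for all $x$, which is then also denoted by $\beta$.) Let $\mathsf{Mor}(\mathsf H,\mathsf A)_\beta$ be the full subgroupoid of $\mathsf{Mor}(\mathsf H,\mathsf A)$ on the objects $(\mathsf U,\psi,u)$ such that the class $\bar u_*\bar\psi_*^{-1}[\overline{\mathsf H}]$ belongs to this set. Then $\tilde\Lambda_\xi$ preserves $\mathsf{Mor}(\mathsf H,\mathsf A)_\beta$ for every $\xi\in K^1$ (an object belongs to it if and only if its image does), $(\tilde\Lambda,\tilde\Omega)$ restricts to a generalized cocycle $(\tilde\Lambda_\beta,\tilde\Omega_\beta)$ of $\mathsf K$ with values in $\mathsf{Mor}(\mathsf H,\mathsf A)_\beta$, and $\mathsf{Mor}(\mathsf H,\mathsf A)_\beta\rtimes_{\tilde\Lambda_\beta,\tilde\Omega_\beta}\mathsf K$ is an extension of $\mathsf K$ by $\mathsf{Mor}(\mathsf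 H,\mathsf A)_\beta$ with pre-action map $\tilde\Lambda_\beta$ and cofactor $\tilde\Omega_\beta$. 3. If $K^0$ is connected, the supposition on $\beta$ in 2 is satisfied for every $n$ and every $\beta\in H_n(\overline{\mathsf G},\mathbb Z)$. -/

import Mathlib

open scoped Manifold ContDiff Topology

universe u v w z

/-! ### Groupoids through their spaces of objects and arrows

Arrows are composed from left to right: `mul g h` is the composite of `g : x → y` and `h : y → z`.
It is a total function whose values are meaningful only when `tgt g = src h`. -/

/-- The structure maps of a groupoid with set of objects `O` and set of arrows `R`. -/
structure GroupoidData (O : Type u) (R : Type v) where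
  src : R → O
  tgt : R → O
  mul : R → R → R
  one : O → R
  inv : R → R

/-- The groupoid axioms. -/
structure GroupoidData.IsGroupoid {O : Type u} {R : Type v} (D : GroupoidData O R) : Prop where
  src_one : ∀ x, D.src (D.one x) = x
  tgt_one : ∀ x, D.tgt (D.one x) = x
  src_mul : ∀ g h, D.tgt g = D.src h → D.src (D.mul g h) = D.src g
  tgt_mul : ∀ g h, D.tgt g = D.src h → D.tgt (D.mul g h) = D.tgt h
  src_inv : ∀ g, D.src (D.inv g) = D.tgt g
  tgt_inv : ∀ g, D.tgt (D.inv g) = D.src g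
  assoc : ∀ g h k, D.tgt g = D.src h → D.tgt h = D.src k →
    D.mul (D.mul g h) k = D.mul g (D.mul h k)
  one_mul : ∀ g, D.mul (D.one (D.src g)) g = g
  mul_one : ∀ g, D.mul g (D.one (D.tgt g)) = g
  mul_inv : ∀ g, D.mul g (D.inv g) = D.one (D.src g)
  inv_mul : ∀ g, D.mul (D.inv g) g = D.one (D.tgt g)

/-- The coarse space: objects modulo the relation of being joined by an arrow. -/
def GroupoidData.Coarse {O : Type u} {R : Type v} (D : GroupoidData O R) : Type u :=
  Quot fun a b : O => ∃ g : R, D.src g = a ∧ D.tgt g = b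

instance {O : Type u} {R : Type v} [TopologicalSpace O] (D : GroupoidData O R) :
    TopologicalSpace D.Coarse :=
  inferInstanceAs (TopologicalSpace (Quot fun a b : O => ∃ g : R, D.src g = a ∧ D.tgt g = b))

/-- A groupoid. -/
structure Gpd where
  Obj : Type u
  Arr : Type v
  str : GroupoidData Obj Arr
  isGroupoid : str.IsGroupoid

namespace Gpd

/-- Source of an arrow. -/
abbrev src (G : Gpd.{u, v}) : G.Arr → G.Obj := G.str.src
/-- Target of an arrow. -/
abbrev tgt (G : Gpd.{u, v}) : G.Arr → G.Obj := G.str.tgt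
/-- Composition, from left to right. -/
abbrev mul (G : Gpd.{u, v}) : G.Arr → G.Arr → G.Arr := G.str.mul
/-- Unit arrows. -/
abbrev one (G : Gpd.{u, v}) : G.Obj → G.Arr := G.str.one
/-- Inverse arrows. -/
abbrev inv (G : Gpd.{u, v}) : G.Arr → G.Arr := G.str.inv

theorem src_mul (G : Gpd.{u, v}) {g h : G.Arr} (e : G.tgt g = G.src h) :
    G.src (G.mul g h) = G.src g := G.isGroupoid.src_mul g h e

theorem tgt_mul (G : Gpd.{u, v}) {g h : G.Arr} (e : G.tgt g = G.src h) :
    G.tgt (G.mul g h) = G.tgt h := G.isGroupoid.tgt_mul g h e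

theorem src_one (G : Gpd.{u, v}) (x : G.Obj) : G.src (G.one x) = x := G.isGroupoid.src_one x

theorem tgt_one (G : Gpd.{u, v}) (x : G.Obj) : G.tgt (G.one x) = x := G.isGroupoid.tgt_one x

theorem src_inv (G : Gpd.{u, v}) (g : G.Arr) : G.src (G.inv g) = G.tgt g :=
  G.isGroupoid.src_inv g

theorem tgt_inv (G : Gpd.{u, v}) (g : G.Arr) : G.tgt (G.inv g) = G.src g :=
  G.isGroupoid.tgt_inv g

theorem assoc (G : Gpd.{u, v}) {g h k : G.Arr} (e : G.tgt g = G.src h) (e' : G.tgt h = G.src k) :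
    G.mul (G.mul g h) k = G.mul g (G.mul h k) := G.isGroupoid.assoc g h k e e'

theorem one_mul (G : Gpd.{u, v}) {g : G.Arr} {x : G.Obj} (e : G.src g = x) :
    G.mul (G.one x) g = g := e ▸ G.isGroupoid.one_mul g

theorem mul_one (G : Gpd.{u, v}) {g : G.Arr} {x : G.Obj} (e : G.tgt g = x) :
    G.mul g (G.one x) = g := e ▸ G.isGroupoid.mul_one g

theorem mul_inv (G : Gpd.{u, v}) (g : G.Arr) : G.mul g (G.inv g) = G.one (G.src g) :=
  G.isGroupoid.mul_inv g

theorem inv_mul (G : Gpd.{u, v}) (g : G.Arr) : G.mul (G.inv g) g = G.one (G.tgt g) :=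
  G.isGroupoid.inv_mul g

/-- Functors between groupoids. -/
@[ext] structure Hom (G : Gpd.{u, v}) (H : Gpd.{w, z}) where
  obj : G.Obj → H.Obj
  arr : G.Arr → H.Arr
  src_arr : ∀ g, H.src (arr g) = obj (G.src g)
  tgt_arr : ∀ g, H.tgt (arr g) = obj (G.tgt g)
  arr_one : ∀ x, arr (G.one x) = H.one (obj x)
  arr_mul : ∀ g h, G.tgt g = G.src h → arr (G.mul g h) = H.mul (arr g) (arr h)

/-- The identity functor. -/
def Hom.id (G : Gpd.{u, v}) : Hom G G where
  obj x := x
  arr g := g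
  src_arr _ := rfl
  tgt_arr _ := rfl
  arr_one _ := rfl
  arr_mul _ _ _ := rfl

/-- The composite functor `g ∘ f`. -/
def Hom.comp {G H L : Gpd} (g : Hom H L) (f : Hom G H) : Hom G L where
  obj x := g.obj (f.obj x)
  arr a := g.arr (f.arr a)
  src_arr a := by rw [g.src_arr, f.src_arr]
  tgt_arr a := by rw [g.tgt_arr, f.tgt_arr]
  arr_one x := by rw [f.arr_one, g.arr_one]
  arr_mul a b h := by
    rw [f.arr_mul a b h, g.arr_mul _ _ (by rw [f.tgt_arr, f.src_arr, h])]

/-- `σ` is a natural transformation `f ⇒ g`. -/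
structure IsNatTrans {G : Gpd.{u, v}} {H : Gpd.{w, z}} (f g : Hom G H) (σ : G.Obj → H.Arr) :
    Prop where
  src_eq : ∀ x, H.src (σ x) = f.obj x
  tgt_eq : ∀ x, H.tgt (σ x) = g.obj x
  natural : ∀ a, H.mul (σ (G.src a)) (g.arr a) = H.mul (f.arr a) (σ (G.tgt a))

/-- Strict automorphisms of a groupoid. -/
structure Aut (G : Gpd.{u, v}) where
  hom : Hom G G
  inv : Hom G G
  hom_inv : hom.comp inv = Hom.id G
  inv_hom : inv.comp hom = Hom.id G

open Classical in
/-- The full subgroupoid on a set of objects. -/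
noncomputable def restrict (G : Gpd.{u, v}) (P : Set G.Obj) : Gpd.{u, v} where
  Obj := P
  Arr := {g : G.Arr // G.src g ∈ P ∧ G.tgt g ∈ P}
  str :=
    { src := fun g => ⟨G.src g.1, g.2.1⟩
      tgt := fun g => ⟨G.tgt g.1, g.2.2⟩
      mul := fun g h =>
        if e : G.tgt g.1 = G.src h.1 then
          ⟨G.mul g.1 h.1, by rw [G.src_mul e]; exact g.2.1,
            by rw [G.tgt_mul e]; exact h.2.2⟩
        else g
      one := fun x => ⟨G.one x.1, by rw [G.src_one]; exact x.2,
        by rw [G.tgt_one]; exact x.2⟩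
      inv := fun g => ⟨G.inv g.1, by rw [G.src_inv]; exact g.2.2,
        by rw [G.tgt_inv]; exact g.2.1⟩ }
  isGroupoid := by
    have hG := G.isGroupoid
    refine ⟨fun x => Subtype.ext (hG.src_one _), fun x => Subtype.ext (hG.tgt_one _), ?_, ?_,
      fun g => Subtype.ext (hG.src_inv _), fun g => Subtype.ext (hG.tgt_inv _), ?_, ?_, ?_, ?_, ?_⟩
    · intro g h e
      have e' : G.tgt g.1 = G.src h.1 := congrArg Subtype.val e
      refine Subtype.ext ?_
      simpa only [dif_pos e'] using hG.src_mul _ _ e'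
    · intro g h e
      have e' : G.tgt g.1 = G.src h.1 := congrArg Subtype.val e
      refine Subtype.ext ?_
      simpa only [dif_pos e'] using hG.tgt_mul _ _ e'
    · intro g h k e₁ e₂
      have e₁' : G.tgt g.1 = G.src h.1 := congrArg Subtype.val e₁
      have e₂' : G.tgt h.1 = G.src k.1 := congrArg Subtype.val e₂
      have a₁ : G.tgt (G.mul g.1 h.1) = G.src k.1 := (hG.tgt_mul _ _ e₁').trans e₂'
      have a₂ : G.tgt g.1 = G.src (G.mul h.1 k.1) := e₁'.trans (hG.src_mul _ _ e₂').symm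
      refine Subtype.ext ?_
      simpa only [dif_pos e₁', dif_pos e₂', dif_pos a₁, dif_pos a₂] using hG.assoc _ _ _ e₁' e₂'
    · intro g
      refine Subtype.ext ?_
      simpa only [dif_pos (hG.tgt_one (G.src g.1))] using hG.one_mul _
    · intro g
      refine Subtype.ext ?_
      simpa only [dif_pos (hG.src_one (G.tgt g.1)).symm] using hG.mul_one _
    · intro g
      refine Subtype.ext ?_
      simpa only [dif_pos (hG.src_inv g.1).symm] using hG.mul_inv _
    · intro g
      refine Subtype.ext ?_
      simpa only [dif_pos (hG.tgt_inv g.1)] using hG.inv_mul _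

end Gpd

/-! ### Generalized cocycles and the extensions they define -/

/-- `(Λ, Ω)` is a generalized cocycle of `K` with values in `A` (the algebraic part):
`Ω(ξ, η) : id ⇒ Λ_{ξη}⁻¹ Λ_η Λ_ξ` is a natural transformation for composable `ξ, η`, `Λ` and `Ω`
are normalized, and
`Ω(ξ, η, a) · Ω(ξη, ζ, a₄) = Λ_ξ⁻¹(Ω(η, ζ, a₁)) · Ω(ξ, ηζ, a₅)`, where `a₁ = Λ_ξ a`,
`a₄ = Λ_{ξη}⁻¹ Λ_η Λ_ξ a` and `a₅ = Λ_ξ⁻¹ Λ_{ηζ}⁻¹ Λ_ζ Λ_η Λ_ξ a`. -/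
structure IsGenCocycle (A : Gpd.{u, v}) (K : Gpd.{w, z}) (Λ : K.Arr → A.Aut)
    (Ω : K.Arr → K.Arr → A.Obj → A.Arr) : Prop where
  aut_one : ∀ x, (Λ (K.one x)).hom = Gpd.Hom.id A
  natTrans : ∀ ξ η, K.tgt ξ = K.src η →
    Gpd.IsNatTrans (Gpd.Hom.id A) ((Λ (K.mul ξ η)).inv.comp ((Λ η).hom.comp (Λ ξ).hom)) (Ω ξ η)
  one_left : ∀ η a, Ω (K.one (K.src η)) η a = A.one a
  one_right : ∀ ξ a, Ω ξ (K.one (K.tgt ξ)) a = A.one a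
  cocycle : ∀ ξ η ζ, K.tgt ξ = K.src η → K.tgt η = K.src ζ → ∀ a,
    A.mul (Ω ξ η a)
        (Ω (K.mul ξ η) ζ ((Λ (K.mul ξ η)).inv.obj ((Λ η).hom.obj ((Λ ξ).hom.obj a)))) =
      A.mul ((Λ ξ).inv.arr (Ω η ζ ((Λ ξ).hom.obj a)))
        (Ω ξ (K.mul η ζ) ((Λ ξ).inv.obj ((Λ (K.mul η ζ)).inv.obj
          ((Λ ζ).hom.obj ((Λ η).hom.obj ((Λ ξ).hom.obj a))))))

/-- The structure maps of `A ⋊_{Λ, Ω} K` on `(A⁰ × K⁰, A¹ × K¹)`. -/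
def semidirect (A : Gpd.{u, v}) (K : Gpd.{w, z}) (Λ : K.Arr → A.Aut)
    (Ω : K.Arr → K.Arr → A.Obj → A.Arr) : GroupoidData (A.Obj × K.Obj) (A.Arr × K.Arr) where
  src g := (A.src g.1, K.src g.2)
  tgt g := ((Λ g.2).hom.obj (A.tgt g.1), K.tgt g.2)
  mul g h :=
    (A.mul
      (A.mul (Ω g.2 h.2 (A.src g.1))
        ((Λ (K.mul g.2 h.2)).inv.arr ((Λ h.2).hom.arr ((Λ g.2).hom.arr g.1))))
      ((Λ (K.mul g.2 h.2)).inv.arr ((Λ h.2).hom.arr h.1)),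
     K.mul g.2 h.2)
  one x := (A.one x.1, K.one x.2)
  inv g :=
    (A.mul ((Λ g.2).hom.arr (A.inv g.1))
      ((Λ (K.inv g.2)).inv.arr (A.inv (Ω g.2 (K.inv g.2) (A.src g.1)))),
     K.inv g.2)

/-- The structure maps `G` on `(A⁰ × K⁰, A¹ × K¹)` form a topological product extension of the
groupoid `K` by the groupoid `A`, with pre-action map `Λ` (with values in strict automorphisms)
and cofactor `Ω`. -/
structure IsProductExtension (A : Gpd.{u, v}) (K : Gpd.{w, z}) (Λ : K.Arr → A.Aut)
    (Ω : K.Arr → K.Arr → A.Obj → A.Arr)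
    (G : GroupoidData (A.Obj × K.Obj) (A.Arr × K.Arr)) : Prop where
  isGroupoid : G.IsGroupoid
  /-- source and unit are products -/
  src_eq : ∀ α ξ, G.src (α, ξ) = (A.src α, K.src ξ)
  one_eq : ∀ a x, G.one (a, x) = (A.one a, K.one x)
  /-- the second projection is a functor to `K` -/
  proj_tgt : ∀ g, (G.tgt g).2 = K.tgt g.2
  proj_mul : ∀ g h, G.tgt g = G.src h → (G.mul g h).2 = K.mul g.2 h.2
  /-- the kernel of the projection is `A` over every object of `K` -/
  tgt_fibre : ∀ α x, G.tgt (α, K.one x) = (A.tgt α, x)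
  mul_fibre : ∀ α β x, A.tgt α = A.src β →
    G.mul (α, K.one x) (β, K.one x) = (A.mul α β, K.one x)
  /-- the pre-action map is `Λ` -/
  preaction_obj : ∀ a ξ, G.tgt (A.one a, ξ) = ((Λ ξ).hom.obj a, K.tgt ξ)
  preaction_arr : ∀ α ξ,
    G.mul (G.inv (A.one (A.src α), ξ)) (G.mul (α, K.one (K.src ξ)) (A.one (A.tgt α), ξ)) =
      ((Λ ξ).hom.arr α, K.one (K.tgt ξ))
  /-- the cofactor is `Ω` -/
  cofactor : ∀ ξ η, K.tgt ξ = K.src η → ∀ a,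
    G.mul (G.mul (A.one a, ξ) (A.one ((Λ ξ).hom.obj a), η))
        (G.inv (A.one ((Λ (K.mul ξ η)).inv.obj ((Λ η).hom.obj ((Λ ξ).hom.obj a))), K.mul ξ η)) =
      (Ω ξ η a, K.one (K.src ξ))

/-! ### Lie groupoids -/

/-- A map defined on a subset `S` of a manifold is smooth. (The subsets used below are embedded
submanifolds, and this is smoothness for the submanifold structure.) -/
def SmoothOnSubset {E E' H H' M N : Type*} [NormedAddCommGroup E] [NormedSpace ℝ E]
    [NormedAddCommGroup E'] [NormedSpace ℝ E'] [TopologicalSpace H] [TopologicalSpace H']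
    [TopologicalSpace M] [TopologicalSpace N] [ChartedSpace H M] [ChartedSpace H' N]
    (I : ModelWithCorners ℝ E H) (J : ModelWithCorners ℝ E' H') {S : Set M} (f : S → N) : Prop :=
  ∀ p : S, ∃ F : M → N, (∀ q : S, F q = f q) ∧ ContMDiffWithinAt I J ∞ F S p

/-- A Lie groupoid: objects and arrows are (Hausdorff, second countable) smooth manifolds, the
structure maps are smooth and the source map is a submersion (hence so is the target map). -/
structure LieGroupoid extends Gpd.{u, u} where
  dimObj : ℕ
  dimArr : ℕ
  [topObj : TopologicalSpace Obj]
  [chartedObj : ChartedSpace (EuclideanSpace ℝ (Fin dimObj)) Obj]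
  [manifoldObj : IsManifold (𝓡 dimObj) ∞ Obj]
  [t2Obj : T2Space Obj]
  [countableObj : SecondCountableTopology Obj]
  [topArr : TopologicalSpace Arr]
  [chartedArr : ChartedSpace (EuclideanSpace ℝ (Fin dimArr)) Arr]
  [manifoldArr : IsManifold (𝓡 dimArr) ∞ Arr]
  [t2Arr : T2Space Arr]
  [countableArr : SecondCountableTopology Arr]
  smooth_src : ContMDiff (𝓡 dimArr) (𝓡 dimObj) ∞ str.src
  smooth_tgt : ContMDiff (𝓡 dimArr) (𝓡 dimObj) ∞ str.tgt
  smooth_one : ContMDiff (𝓡 dimObj) (𝓡 dimArr) ∞ str.one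
  smooth_inv : ContMDiff (𝓡 dimArr) (𝓡 dimArr) ∞ str.inv
  submersion_src : ∀ g, Function.Surjective (mfderiv (𝓡 dimArr) (𝓡 dimObj) str.src g)
  smooth_mul : ContMDiffOn ((𝓡 dimArr).prod (𝓡 dimArr)) (𝓡 dimArr) ∞
    (fun p : Arr × Arr => str.mul p.1 p.2) {p | str.tgt p.1 = str.src p.2}

attribute [instance] LieGroupoid.topObj LieGroupoid.chartedObj LieGroupoid.manifoldObj
  LieGroupoid.t2Obj LieGroupoid.countableObj LieGroupoid.topArr LieGroupoid.chartedArr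
  LieGroupoid.manifoldArr LieGroupoid.t2Arr LieGroupoid.countableArr

/-- Strict morphisms of Lie groupoids: smooth functors. -/
structure SMor (A B : LieGroupoid.{u}) extends Gpd.Hom A.toGpd B.toGpd where
  smooth_obj : ContMDiff (𝓡 A.dimObj) (𝓡 B.dimObj) ∞ obj
  smooth_arr : ContMDiff (𝓡 A.dimArr) (𝓡 B.dimArr) ∞ arr

namespace SMor

variable {A B C : LieGroupoid.{u}}

/-- The composite strict morphism `g ∘ f`. -/
def comp (g : SMor B C) (f : SMor A B) : SMor A C where
  toHom := g.toHom.comp f.toHom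
  smooth_obj := g.smooth_obj.comp f.smooth_obj
  smooth_arr := g.smooth_arr.comp f.smooth_arr

/-- A strict morphism `f : A → B` is an equivalence if
`t ∘ pr₂ : A⁰ ×_{f, s} B¹ → B⁰` is a surjective submersion and the square formed by `f¹`, `f⁰ × f⁰`
and the maps `s × t` is a fiber product of manifolds. -/
structure IsEquivalence (f : SMor A B) : Prop where
  surjective : ∀ y : B.Obj, ∃ (x : A.Obj) (h : B.Arr), B.src h = f.obj x ∧ B.tgt h = y
  /-- The tangent space of `A⁰ ×_{f, s} B¹` at `(x, h)` consists of the pairs `(v, v')` with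
  `df v = ds v'`; the differential of `t ∘ pr₂` sends it to `dt v'`. -/
  submersion : ∀ (x : A.Obj) (h : B.Arr), B.src h = f.obj x →
    ∀ w : EuclideanSpace ℝ (Fin B.dimObj),
      ∃ (v : EuclideanSpace ℝ (Fin A.dimObj)) (v' : EuclideanSpace ℝ (Fin B.dimArr)),
        (mfderiv (𝓡 A.dimObj) (𝓡 B.dimObj) f.obj x v : EuclideanSpace ℝ (Fin B.dimObj)) =
          mfderiv (𝓡 B.dimArr) (𝓡 B.dimObj) B.src h v' ∧
        (mfderiv (𝓡 B.dimArr) (𝓡 B.dimObj) B.tgt h v' : EuclideanSpace ℝ (Fin B.dimObj)) = w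
  fiberProduct : ∃ L : {p : A.Obj × B.Arr × A.Obj |
      B.src p.2.1 = f.obj p.1 ∧ B.tgt p.2.1 = f.obj p.2.2} → A.Arr,
    SmoothOnSubset ((𝓡 A.dimObj).prod ((𝓡 B.dimArr).prod (𝓡 A.dimObj))) (𝓡 A.dimArr) L ∧
    (∀ p, A.src (L p) = p.1.1 ∧ f.arr (L p) = p.1.2.1 ∧ A.tgt (L p) = p.1.2.2) ∧
    ∀ g, L ⟨(A.src g, f.arr g, A.tgt g), f.src_arr g, f.tgt_arr g⟩ = g

/-- The continuous map of coarse spaces induced by a strict morphism. -/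
def coarse (f : SMor A B) : C(A.str.Coarse, B.str.Coarse) where
  toFun := Quot.map f.obj fun _ _ ⟨g, hs, ht⟩ =>
    ⟨f.arr g, (f.src_arr g).trans (congrArg f.obj hs), (f.tgt_arr g).trans (congrArg f.obj ht)⟩
  continuous_toFun :=
    continuous_quot_lift _ (continuous_quot_mk.comp f.smooth_obj.continuous)

end SMor

/-- Strict automorphisms of a Lie groupoid. -/
structure LieGroupoid.SAut (A : LieGroupoid.{u}) where
  hom : SMor A A
  inv : SMor A A
  hom_inv : hom.toHom.comp inv.toHom = Gpd.Hom.id A.toGpd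
  inv_hom : inv.toHom.comp hom.toHom = Gpd.Hom.id A.toGpd

/-- The underlying automorphism of the groupoid. -/
def LieGroupoid.SAut.toAut {A : LieGroupoid.{u}} (f : A.SAut) : A.toGpd.Aut :=
  ⟨f.hom.toHom, f.inv.toHom, f.hom_inv, f.inv_hom⟩

/-- A (smooth) generalized cocycle of the Lie groupoid `K` with values in the Lie groupoid `A`. -/
structure IsLieGenCocycle (A K : LieGroupoid.{u}) (Λ : K.Arr → A.SAut)
    (Ω : K.Arr → K.Arr → A.Obj → A.Arr) : Prop where
  isGenCocycle : IsGenCocycle A.toGpd K.toGpd (fun ξ => (Λ ξ).toAut) Ω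
  smooth_obj : ContMDiff ((𝓡 K.dimArr).prod (𝓡 A.dimObj)) (𝓡 A.dimObj) ∞
    fun p : K.Arr × A.Obj => (Λ p.1).hom.obj p.2
  smooth_arr : ContMDiff ((𝓡 K.dimArr).prod (𝓡 A.dimArr)) (𝓡 A.dimArr) ∞
    fun p : K.Arr × A.Arr => (Λ p.1).hom.arr p.2
  smooth_Ω : ContMDiffOn (((𝓡 K.dimArr).prod (𝓡 K.dimArr)).prod (𝓡 A.dimObj)) (𝓡 A.dimArr) ∞
    (fun p : (K.Arr × K.Arr) × A.Obj => Ω p.1.1 p.1.2 p.2) {p | K.tgt p.1.1 = K.src p.1.2}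

/-! ### Local sections of the submersions that occur in equivalences -/

theorem exists_smooth_section_of_surjective_fderiv {E G : Type*} [NormedAddCommGroup E]
    [NormedSpace ℝ E] [FiniteDimensional ℝ E] [NormedAddCommGroup G] [NormedSpace ℝ G]
    [FiniteDimensional ℝ G] (F : E → G) (p : E) (hF : ContDiffAt ℝ ∞ F p)
    (hs : Function.Surjective (fderiv ℝ F p)) :
    ∃ σ : G → E, ContDiffAt ℝ ∞ σ (F p) ∧ σ (F p) = p ∧ ∀ᶠ z in 𝓝 (F p), F (σ z) = z := by
  obtain ⟨R, hR⟩ := (fderiv ℝ F p).exists_rightInverse_of_surjective (LinearMap.range_eq_top.2 hs)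
  have hA : ContDiffAt ℝ ∞ (fun z : G => p + R z) 0 := by fun_prop
  have hp : p + R (0 : G) = p := by simp
  have hQ : ContDiffAt ℝ ∞ (fun z : G => F (p + R z)) 0 := by
    refine ContDiffAt.comp (0 : G) (g := F) (f := fun z : G => p + R z) ?_ hA
    rwa [hp]
  have hd : HasFDerivAt (fun z : G => F (p + R z))
      ((ContinuousLinearEquiv.refl ℝ G : G ≃L[ℝ] G) : G →L[ℝ] G) 0 := by
    have h1 : HasFDerivAt F (fderiv ℝ F p) (p + R (0 : G)) := by
      rw [hp]
      exact (hF.differentiableAt (by simp)).hasFDerivAt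
    have h2 : HasFDerivAt (fun z : G => p + R z) R 0 := R.hasFDerivAt.const_add p
    have h3 := h1.comp (0 : G) h2
    rw [hR] at h3
    exact h3
  have hn : (∞ : WithTop ℕ∞) ≠ 0 := by simp
  have hst := hQ.hasStrictFDerivAt' hd hn
  have hv : F (p + R (0 : G)) = F p := by rw [hp]
  have hi : hQ.localInverse hd hn (F p) = 0 := by
    have := hQ.localInverse_apply_image hd hn
    simpa [hp] using this
  have hsm : ContDiffAt ℝ ∞ (hQ.localInverse hd hn) (F p) := by
    have := hQ.to_localInverse hd hn
    simpa [hp] using this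
  refine ⟨fun z => p + R (hQ.localInverse hd hn z), ?_, ?_, ?_⟩
  · exact contDiffAt_const.add (R.contDiff.contDiffAt.comp _ hsm)
  · simp [hi]
  · have := hst.eventually_right_inverse
    rw [hv] at this
    exact this

theorem writtenInExtChartAt_smooth_and_mfderiv {EM E M N : Type*}
    [NormedAddCommGroup EM] [NormedSpace ℝ EM] [NormedAddCommGroup E] [NormedSpace ℝ E]
    [TopologicalSpace M] [ChartedSpace EM M] [TopologicalSpace N] [ChartedSpace E N]
    (g : M → N) (hg : ContMDiff 𝓘(ℝ, EM) 𝓘(ℝ, E) ∞ g) (q : M) :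
    ContDiffAt ℝ ∞ (writtenInExtChartAt 𝓘(ℝ, EM) 𝓘(ℝ, E) q g) (extChartAt 𝓘(ℝ, EM) q q) ∧
      mfderiv 𝓘(ℝ, EM) 𝓘(ℝ, E) g q =
        fderiv ℝ (writtenInExtChartAt 𝓘(ℝ, EM) 𝓘(ℝ, E) q g) (extChartAt 𝓘(ℝ, EM) q q) := by
  constructor
  · have := (contMDiffAt_iff.1 (hg q)).2
    simpa [writtenInExtChartAt, contDiffWithinAt_univ] using this
  · have h1 : MDifferentiableAt 𝓘(ℝ, EM) 𝓘(ℝ, E) g q := (hg q).mdifferentiableAt (by simp)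
    simp [mfderiv, h1]
    rfl

theorem exists_smooth_section_fiberProduct {E₁ E₂ E : Type*}
    [NormedAddCommGroup E₁] [NormedSpace ℝ E₁] [FiniteDimensional ℝ E₁]
    [NormedAddCommGroup E₂] [NormedSpace ℝ E₂] [FiniteDimensional ℝ E₂]
    [NormedAddCommGroup E] [NormedSpace ℝ E] [FiniteDimensional ℝ E]
    {M₁ M₂ N : Type*} [TopologicalSpace M₁] [ChartedSpace E₁ M₁] [IsManifold 𝓘(ℝ, E₁) ∞ M₁]
    [TopologicalSpace M₂] [ChartedSpace E₂ M₂] [IsManifold 𝓘(ℝ, E₂) ∞ M₂]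
    [TopologicalSpace N] [ChartedSpace E N] [IsManifold 𝓘(ℝ, E) ∞ N]
    (f : M₁ → N) (s t : M₂ → N) (hf : ContMDiff 𝓘(ℝ, E₁) 𝓘(ℝ, E) ∞ f)
    (hs : ContMDiff 𝓘(ℝ, E₂) 𝓘(ℝ, E) ∞ s) (ht : ContMDiff 𝓘(ℝ, E₂) 𝓘(ℝ, E) ∞ t)
    (x : M₁) (h : M₂) (e : s h = f x)
    (hsub : ∀ w : E, ∃ w' : E₂, mfderiv 𝓘(ℝ, E₂) 𝓘(ℝ, E) s h w' = w)
    (htr : ∀ w : E, ∃ (v : E₁) (v' : E₂),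
      (mfderiv 𝓘(ℝ, E₁) 𝓘(ℝ, E) f x v : E) = mfderiv 𝓘(ℝ, E₂) 𝓘(ℝ, E) s h v' ∧
      (mfderiv 𝓘(ℝ, E₂) 𝓘(ℝ, E) t h v' : E) = w) :
    ∃ (σ₁ : N → M₁) (σ₂ : N → M₂), ContMDiffAt 𝓘(ℝ, E) 𝓘(ℝ, E₁) ∞ σ₁ (t h) ∧
      ContMDiffAt 𝓘(ℝ, E) 𝓘(ℝ, E₂) ∞ σ₂ (t h) ∧ σ₁ (t h) = x ∧ σ₂ (t h) = h ∧
      ∀ᶠ z in 𝓝 (t h), s (σ₂ z) = f (σ₁ z) ∧ t (σ₂ z) = z := by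
  obtain ⟨cf, df⟩ := writtenInExtChartAt_smooth_and_mfderiv f hf x
  obtain ⟨cs, ds⟩ := writtenInExtChartAt_smooth_and_mfderiv s hs h
  obtain ⟨ct, dt⟩ := writtenInExtChartAt_smooth_and_mfderiv t ht h
  rw [ds] at hsub
  rw [df, ds, dt] at htr
  have hcharts : extChartAt 𝓘(ℝ, E) (s h) = extChartAt 𝓘(ℝ, E) (f x) := by rw [e]
  set φ := extChartAt 𝓘(ℝ, E) (f x) with hφ
  set χ := extChartAt 𝓘(ℝ, E) (t h) with hχ
  set φ₁ := extChartAt 𝓘(ℝ, E₁) x with hφ₁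
  set φ₂ := extChartAt 𝓘(ℝ, E₂) h with hφ₂
  set Wf := writtenInExtChartAt 𝓘(ℝ, E₁) 𝓘(ℝ, E) x f with hWf
  set Ws := writtenInExtChartAt 𝓘(ℝ, E₂) 𝓘(ℝ, E) h s with hWs
  set Wt := writtenInExtChartAt 𝓘(ℝ, E₂) 𝓘(ℝ, E) h t with hWt
  have eWf : ∀ a, Wf a = φ (f (φ₁.symm a)) := fun a => rfl
  have eWs : ∀ a, Ws a = φ (s (φ₂.symm a)) := fun a => by rw [← hcharts]; rfl
  have eWt : ∀ a, Wt a = χ (t (φ₂.symm a)) := fun a => rfl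
  have e₁ : φ₁.symm (φ₁ x) = x := extChartAt_to_inv x
  have e₂ : φ₂.symm (φ₂ h) = h := extChartAt_to_inv h
  let F : E₁ × E₂ → E × E := fun p => (Wf p.1 - Ws p.2, Wt p.2)
  let p₀ : E₁ × E₂ := (φ₁ x, φ₂ h)
  have cf' : ContDiffAt ℝ ∞ (fun p : E₁ × E₂ => Wf p.1) p₀ :=
    ContDiffAt.comp p₀ (g := Wf) (f := Prod.fst) cf contDiffAt_fst
  have cs' : ContDiffAt ℝ ∞ (fun p : E₁ × E₂ => Ws p.2) p₀ :=
    ContDiffAt.comp p₀ (g := Ws) (f := Prod.snd) cs contDiffAt_snd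
  have ct' : ContDiffAt ℝ ∞ (fun p : E₁ × E₂ => Wt p.2) p₀ :=
    ContDiffAt.comp p₀ (g := Wt) (f := Prod.snd) ct contDiffAt_snd
  have cF : ContDiffAt ℝ ∞ F p₀ := (cf'.sub cs').prodMk ct'
  have hdF : HasFDerivAt F
      ((((fderiv ℝ Wf (φ₁ x)).comp (ContinuousLinearMap.fst ℝ E₁ E₂)) -
        ((fderiv ℝ Ws (φ₂ h)).comp (ContinuousLinearMap.snd ℝ E₁ E₂))).prod
        ((fderiv ℝ Wt (φ₂ h)).comp (ContinuousLinearMap.snd ℝ E₁ E₂))) p₀ := by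
    have a1 : HasFDerivAt Wf (fderiv ℝ Wf (φ₁ x)) p₀.1 :=
      (cf.differentiableAt (by simp)).hasFDerivAt
    have a2 : HasFDerivAt Ws (fderiv ℝ Ws (φ₂ h)) p₀.2 :=
      (cs.differentiableAt (by simp)).hasFDerivAt
    have a3 : HasFDerivAt Wt (fderiv ℝ Wt (φ₂ h)) p₀.2 :=
      (ct.differentiableAt (by simp)).hasFDerivAt
    exact ((a1.comp p₀ hasFDerivAt_fst).sub (a2.comp p₀ hasFDerivAt_snd)).prodMk
      (a3.comp p₀ hasFDerivAt_snd)
  have hsurj : Function.Surjective (fderiv ℝ F p₀) := by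
    rw [hdF.fderiv]
    rintro ⟨u, w⟩
    obtain ⟨w₁, hw₁⟩ := hsub (-u)
    obtain ⟨v, v', hv, hv'⟩ := htr (w - fderiv ℝ Wt (φ₂ h) w₁)
    refine ⟨(v, v' + w₁), ?_⟩
    have b1 : fderiv ℝ Wf (φ₁ x) v - fderiv ℝ Ws (φ₂ h) (v' + w₁) = u := by
      have hw₁' : fderiv ℝ Ws (φ₂ h) w₁ = -u := hw₁
      have hvv : fderiv ℝ Wf (φ₁ x) v = fderiv ℝ Ws (φ₂ h) v' := hv
      rw [map_add, hw₁', hvv]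
      abel
    have b2 : fderiv ℝ Wt (φ₂ h) (v' + w₁) = w := by
      have hvv : fderiv ℝ Wt (φ₂ h) v' = w - fderiv ℝ Wt (φ₂ h) w₁ := hv'
      rw [map_add, hvv]
      abel
    exact Prod.ext b1 b2
  obtain ⟨σ, cσ, σ0, hσ⟩ := exists_smooth_section_of_surjective_fderiv F p₀ cF hsurj
  have hF0 : F p₀ = (0, χ (t h)) := by
    refine Prod.ext ?_ ?_
    · change Wf (φ₁ x) - Ws (φ₂ h) = 0
      rw [eWf, eWs, e₁, e₂, e, sub_self]
    · change Wt (φ₂ h) = _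
      rw [eWt, e₂]
  rw [hF0] at cσ σ0 hσ
  have cχ : ContMDiffAt 𝓘(ℝ, E) 𝓘(ℝ, E) ∞ χ (t h) := contMDiffAt_extChartAt
  have cι : ContMDiffAt 𝓘(ℝ, E) 𝓘(ℝ, E₁ × E₂) ∞ (fun z : N => σ (0, χ z)) (t h) := by
    have i1 : ContDiffAt ℝ ∞ (fun w : E => σ (0, w)) (χ (t h)) :=
      ContDiffAt.comp (χ (t h)) (g := σ) (f := fun w : E => ((0 : E), w)) cσ (by fun_prop)
    exact ContMDiffAt.comp (t h) (g := fun w : E => σ (0, w)) (f := χ) i1.contMDiffAt cχ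
  have cφ₁ : ContMDiffAt 𝓘(ℝ, E₁) 𝓘(ℝ, E₁) ∞ φ₁.symm (φ₁ x) :=
    (contMDiffOn_extChartAt_symm x).contMDiffAt (extChartAt_target_mem_nhds x)
  have cφ₂ : ContMDiffAt 𝓘(ℝ, E₂) 𝓘(ℝ, E₂) ∞ φ₂.symm (φ₂ h) :=
    (contMDiffOn_extChartAt_symm h).contMDiffAt (extChartAt_target_mem_nhds h)
  have c1 : ContMDiffAt 𝓘(ℝ, E) 𝓘(ℝ, E₁) ∞ (fun z : N => φ₁.symm (σ (0, χ z)).1) (t h) := by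
    have i1 : ContMDiffAt 𝓘(ℝ, E) 𝓘(ℝ, E₁) ∞ (fun z : N => (σ (0, χ z)).1) (t h) :=
      ContMDiffAt.comp (t h) (g := Prod.fst) (f := fun z : N => σ (0, χ z))
        (contDiff_fst.contDiffAt.contMDiffAt) cι
    refine ContMDiffAt.comp (t h) (g := φ₁.symm) ?_ i1
    simpa only [σ0] using cφ₁
  have c2 : ContMDiffAt 𝓘(ℝ, E) 𝓘(ℝ, E₂) ∞ (fun z : N => φ₂.symm (σ (0, χ z)).2) (t h) := by
    have i1 : ContMDiffAt 𝓘(ℝ, E) 𝓘(ℝ, E₂) ∞ (fun z : N => (σ (0, χ z)).2) (t h) :=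
      ContMDiffAt.comp (t h) (g := Prod.snd) (f := fun z : N => σ (0, χ z))
        (contDiff_snd.contDiffAt.contMDiffAt) cι
    refine ContMDiffAt.comp (t h) (g := φ₂.symm) ?_ i1
    simpa only [σ0] using cφ₂
  have v1 : φ₁.symm (σ (0, χ (t h))).1 = x := by rw [σ0]; exact e₁
  have v2 : φ₂.symm (σ (0, χ (t h))).2 = h := by rw [σ0]; exact e₂
  refine ⟨_, _, c1, c2, v1, v2, ?_⟩
  have hcont : Filter.Tendsto (fun z : N => ((0 : E), χ z)) (𝓝 (t h)) (𝓝 (0, χ (t h))) :=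
    tendsto_const_nhds.prodMk_nhds cχ.continuousAt
  have n1 : ∀ᶠ z in 𝓝 (t h), f (φ₁.symm (σ (0, χ z)).1) ∈ φ.source := by
    have hc : ContinuousAt (fun z : N => f (φ₁.symm (σ (0, χ z)).1)) (t h) :=
      ContinuousAt.comp (g := f) hf.continuous.continuousAt c1.continuousAt
    refine hc (?_ : φ.source ∈ 𝓝 (f (φ₁.symm (σ (0, χ (t h))).1)))
    rw [v1]
    exact extChartAt_source_mem_nhds (f x)
  have n2 : ∀ᶠ z in 𝓝 (t h), s (φ₂.symm (σ (0, χ z)).2) ∈ φ.source := by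
    have hc : ContinuousAt (fun z : N => s (φ₂.symm (σ (0, χ z)).2)) (t h) :=
      ContinuousAt.comp (g := s) hs.continuous.continuousAt c2.continuousAt
    refine hc (?_ : φ.source ∈ 𝓝 (s (φ₂.symm (σ (0, χ (t h))).2)))
    rw [v2, e]
    exact extChartAt_source_mem_nhds (f x)
  have n3 : ∀ᶠ z in 𝓝 (t h), t (φ₂.symm (σ (0, χ z)).2) ∈ χ.source := by
    have hc : ContinuousAt (fun z : N => t (φ₂.symm (σ (0, χ z)).2)) (t h) :=
      ContinuousAt.comp (g := t) ht.continuous.continuousAt c2.continuousAt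
    refine hc (?_ : χ.source ∈ 𝓝 (t (φ₂.symm (σ (0, χ (t h))).2)))
    rw [v2]
    exact extChartAt_source_mem_nhds (t h)
  have n4 : ∀ᶠ z in 𝓝 (t h), z ∈ χ.source := extChartAt_source_mem_nhds (t h)
  filter_upwards [n1, n2, n3, n4, hcont.eventually hσ] with z m1 m2 m3 m4 m5
  have k1 : Wf (σ (0, χ z)).1 - Ws (σ (0, χ z)).2 = 0 := congrArg Prod.fst m5
  have k2 : Wt (σ (0, χ z)).2 = χ z := congrArg Prod.snd m5
  rw [eWf, eWs, sub_eq_zero] at k1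
  rw [eWt] at k2
  exact ⟨φ.injOn m2 m1 k1.symm, χ.injOn m3 m4 k2⟩

theorem SMor.IsEquivalence.exists_section {A B : LieGroupoid.{u}} {f : SMor A B}
    (hf : f.IsEquivalence) (x : A.Obj) (h : B.Arr) (e : B.src h = f.obj x) :
    ∃ (σ₁ : B.Obj → A.Obj) (σ₂ : B.Obj → B.Arr),
      ContMDiffAt (𝓡 B.dimObj) (𝓡 A.dimObj) ∞ σ₁ (B.tgt h) ∧
      ContMDiffAt (𝓡 B.dimObj) (𝓡 B.dimArr) ∞ σ₂ (B.tgt h) ∧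
      σ₁ (B.tgt h) = x ∧ σ₂ (B.tgt h) = h ∧
      ∀ᶠ y in 𝓝 (B.tgt h), B.src (σ₂ y) = f.obj (σ₁ y) ∧ B.tgt (σ₂ y) = y :=
  exists_smooth_section_fiberProduct f.obj B.src B.tgt f.smooth_obj B.smooth_src B.smooth_tgt
    x h e (B.submersion_src h) (hf.submersion x h e)

theorem SMor.IsEquivalence.eq_of_arr_eq {A B : LieGroupoid.{u}} {f : SMor A B}
    (hf : f.IsEquivalence) {g g' : A.Arr} (hs : A.src g = A.src g') (ht : A.tgt g = A.tgt g')
    (h : f.arr g = f.arr g') : g = g' := by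
  obtain ⟨L, -, -, hL⟩ := hf.fiberProduct
  rw [← hL g, ← hL g']
  congr 1
  exact Subtype.ext (by simp only [hs, ht, h])

theorem SmoothOnSubset.contMDiffWithinAt {E E' H H' M N : Type*} [NormedAddCommGroup E]
    [NormedSpace ℝ E] [NormedAddCommGroup E'] [NormedSpace ℝ E'] [TopologicalSpace H]
    [TopologicalSpace H'] [TopologicalSpace M] [TopologicalSpace N] [ChartedSpace H M]
    [ChartedSpace H' N] {I : ModelWithCorners ℝ E H} {J : ModelWithCorners ℝ E' H'} {S : Set M}
    {f : S → N} (hf : SmoothOnSubset I J f) (p : S) {F : M → N} (hF : ∀ q : S, F q = f q) :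
    ContMDiffWithinAt I J ∞ F S p := by
  obtain ⟨F', hF', h⟩ := hf p
  exact h.congr (fun q hq => (hF ⟨q, hq⟩).trans (hF' ⟨q, hq⟩).symm)
    ((hF p).trans (hF' p).symm)

/-! ### Generalized morphisms and the morphism groupoid -/

/-- A generalized morphism `H ⇀ A`: an equivalence `ψ : U → H` and a strict morphism `U → A`. -/
structure GenMor (H A : LieGroupoid.{u}) where
  U : LieGroupoid.{u}
  ψ : SMor U H
  equivalence : ψ.IsEquivalence
  map : SMor U A

namespace GenMor

variable {H A B : LieGroupoid.{u}}

/-- The objects `(a₁, h, a₂)`, `h : ψ₁(a₁) → ψ₂(a₂)`, of the fiber product `U₁ ×_H U₂`. -/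
def fiberObj (x y : GenMor H A) : Set (x.U.Obj × H.Arr × y.U.Obj) :=
  {p | H.src p.2.1 = x.ψ.obj p.1 ∧ H.tgt p.2.1 = y.ψ.obj p.2.2}

/-- Arrows between generalized morphisms: natural transformations `u₁ ∘ π₁ ⇒ u₂ ∘ π₂` of strict
morphisms `U₁ ×_H U₂ → A`. An arrow of `U₁ ×_H U₂` from `p = (a₁, h, a₂)` to `q = (b₁, k, b₂)` is
a pair `g₁ : a₁ → b₁`, `g₂ : a₂ → b₂` with `ψ₁(g₁) k = h ψ₂(g₂)`. -/
@[ext] structure Hom (x y : GenMor H A) where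
  toFun : x.fiberObj y → A.Arr
  smooth : SmoothOnSubset
    ((𝓡 x.U.dimObj).prod ((𝓡 H.dimArr).prod (𝓡 y.U.dimObj))) (𝓡 A.dimArr) toFun
  src_eq : ∀ p, A.src (toFun p) = x.map.obj p.1.1
  tgt_eq : ∀ p, A.tgt (toFun p) = y.map.obj p.1.2.2
  natural : ∀ (p q : x.fiberObj y) (g₁ : x.U.Arr) (g₂ : y.U.Arr),
    x.U.src g₁ = p.1.1 → x.U.tgt g₁ = q.1.1 → y.U.src g₂ = p.1.2.2 → y.U.tgt g₂ = q.1.2.2 →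
    H.mul (x.ψ.arr g₁) q.1.2.1 = H.mul p.1.2.1 (y.ψ.arr g₂) →
    A.mul (toFun p) (y.map.arr g₂) = A.mul (x.map.arr g₁) (toFun q)

theorem exists_lift (x : GenMor H A) :
    ∃ L : x.fiberObj x → x.U.Arr,
      SmoothOnSubset ((𝓡 x.U.dimObj).prod ((𝓡 H.dimArr).prod (𝓡 x.U.dimObj))) (𝓡 x.U.dimArr) L ∧
      ∀ p, x.U.src (L p) = p.1.1 ∧ x.ψ.arr (L p) = p.1.2.1 ∧ x.U.tgt (L p) = p.1.2.2 := by
  obtain ⟨L, h₁, h₂, -⟩ := x.equivalence.fiberProduct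
  exact ⟨L, h₁, h₂⟩

/-- For `(a₁, h, a₂)` with `h : ψ(a₁) → ψ(a₂)`, the arrow `a₁ → a₂` of `U` that lifts `h`. -/
noncomputable def lift (x : GenMor H A) : x.fiberObj x → x.U.Arr := x.exists_lift.choose

theorem lift_smooth (x : GenMor H A) : SmoothOnSubset
    ((𝓡 x.U.dimObj).prod ((𝓡 H.dimArr).prod (𝓡 x.U.dimObj))) (𝓡 x.U.dimArr) x.lift :=
  x.exists_lift.choose_spec.1

theorem src_lift (x : GenMor H A) (p : x.fiberObj x) : x.U.src (x.lift p) = p.1.1 :=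
  (x.exists_lift.choose_spec.2 p).1

theorem arr_lift (x : GenMor H A) (p : x.fiberObj x) : x.ψ.arr (x.lift p) = p.1.2.1 :=
  (x.exists_lift.choose_spec.2 p).2.1

theorem tgt_lift (x : GenMor H A) (p : x.fiberObj x) : x.U.tgt (x.lift p) = p.1.2.2 :=
  (x.exists_lift.choose_spec.2 p).2.2

/-- The unit arrow of a generalized morphism. -/
noncomputable def Hom.id (x : GenMor H A) : Hom x x where
  toFun p := x.map.arr (x.lift p)
  smooth p := by
    obtain ⟨F, hF, hs⟩ := x.lift_smooth p
    exact ⟨fun q => x.map.arr (F q), fun q => congrArg x.map.arr (hF q),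
      ContMDiffAt.comp_contMDiffWithinAt (p : x.U.Obj × H.Arr × x.U.Obj) (g := x.map.arr) (f := F)
        (x.map.smooth_arr _) hs⟩
  src_eq p := by rw [x.map.src_arr, x.src_lift]
  tgt_eq p := by rw [x.map.tgt_arr, x.tgt_lift]
  natural p q g₁ g₂ hs₁ ht₁ hs₂ ht₂ h := by
    have e₁ : x.U.tgt (x.lift p) = x.U.src g₂ := (x.tgt_lift p).trans hs₂.symm
    have e₂ : x.U.tgt g₁ = x.U.src (x.lift q) := ht₁.trans (x.src_lift q).symm
    rw [← x.map.arr_mul _ _ e₁, ← x.map.arr_mul _ _ e₂]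
    congr 1
    refine x.equivalence.eq_of_arr_eq ?_ ?_ ?_
    · rw [x.U.src_mul e₁, x.U.src_mul e₂, x.src_lift, hs₁]
    · rw [x.U.tgt_mul e₁, x.U.tgt_mul e₂, x.tgt_lift, ht₂]
    · rw [x.ψ.arr_mul _ _ e₁, x.ψ.arr_mul _ _ e₂, x.arr_lift, x.arr_lift, h]

theorem inv_mem_fiberObj {x y : GenMor H A} (p : y.fiberObj x) :
    (p.1.2.2, H.inv p.1.2.1, p.1.1) ∈ x.fiberObj y :=
  ⟨(H.src_inv _).trans p.2.2, (H.tgt_inv _).trans p.2.1⟩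

theorem comp_mem_fiberObj {x y z : GenMor H A} {p : x.U.Obj × H.Arr × y.U.Obj}
    {q : y.U.Obj × H.Arr × z.U.Obj} (hp : p ∈ x.fiberObj y) (hq : q ∈ y.fiberObj z)
    (e : p.2.2 = q.1) : (p.1, H.mul p.2.1 q.2.1, q.2.2) ∈ x.fiberObj z := by
  have h : H.tgt p.2.1 = H.src q.2.1 := by rw [hp.2, hq.1, e]
  exact ⟨(H.src_mul h).trans hp.1, (H.tgt_mul h).trans hq.2⟩

/-- The inverse arrow. -/
def Hom.inv {x y : GenMor H A} (α : Hom x y) : Hom y x where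
  toFun p := A.inv (α.toFun ⟨(p.1.2.2, H.inv p.1.2.1, p.1.1), inv_mem_fiberObj p⟩)
  smooth p := by
    obtain ⟨F, hF, hs⟩ := α.smooth ⟨(p.1.2.2, H.inv p.1.2.1, p.1.1), inv_mem_fiberObj p⟩
    refine ⟨fun q => A.inv (F (q.2.2, H.inv q.2.1, q.1)), fun q => congrArg A.inv
      (hF ⟨(q.1.2.2, H.inv q.1.2.1, q.1.1), inv_mem_fiberObj q⟩), ?_⟩
    have hi : ContMDiff ((𝓡 y.U.dimObj).prod ((𝓡 H.dimArr).prod (𝓡 x.U.dimObj)))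
        ((𝓡 x.U.dimObj).prod ((𝓡 H.dimArr).prod (𝓡 y.U.dimObj))) ∞
        (fun q : y.U.Obj × H.Arr × x.U.Obj => (q.2.2, H.inv q.2.1, q.1)) :=
      (contMDiff_snd.comp contMDiff_snd).prodMk
        ((H.smooth_inv.comp (contMDiff_fst.comp contMDiff_snd)).prodMk contMDiff_fst)
    have hc := ContMDiffWithinAt.comp (p : y.U.Obj × H.Arr × x.U.Obj) (g := F)
      (f := fun q : y.U.Obj × H.Arr × x.U.Obj => (q.2.2, H.inv q.2.1, q.1)) hs
      (hi _).contMDiffWithinAt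
      (fun q (hq : q ∈ y.fiberObj x) => inv_mem_fiberObj (x := x) (y := y) ⟨q, hq⟩)
    exact ContMDiffAt.comp_contMDiffWithinAt (p : y.U.Obj × H.Arr × x.U.Obj) (g := A.inv)
      (A.smooth_inv _) hc
  src_eq p := by rw [A.src_inv, α.tgt_eq]
  tgt_eq p := by rw [A.tgt_inv, α.src_eq]
  natural p q g₁ g₂ hs₁ ht₁ hs₂ ht₂ h := by
    have a₁ : H.tgt p.1.2.1 = H.src (x.ψ.arr g₂) := by rw [p.2.2, x.ψ.src_arr, hs₂]
    have a₂ : H.tgt (y.ψ.arr g₁) = H.src q.1.2.1 := by rw [q.2.1, y.ψ.tgt_arr, ht₁]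
    have h' : H.mul (x.ψ.arr g₂) (H.inv q.1.2.1) = H.mul (H.inv p.1.2.1) (y.ψ.arr g₁) := by
      have b₁ : H.src (x.ψ.arr g₂) = H.tgt p.1.2.1 := a₁.symm
      have b₂ : H.tgt (x.ψ.arr g₂) = H.tgt q.1.2.1 := by
        rw [x.ψ.tgt_arr, ht₂]; exact q.2.2.symm
      have b₃ : H.src (y.ψ.arr g₁) = H.src p.1.2.1 := by
        rw [y.ψ.src_arr, hs₁]; exact p.2.1.symm
      calc H.mul (x.ψ.arr g₂) (H.inv q.1.2.1)
          = H.mul (H.mul (H.mul (H.inv p.1.2.1) p.1.2.1) (x.ψ.arr g₂)) (H.inv q.1.2.1) := by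
            rw [H.inv_mul, H.one_mul b₁]
        _ = H.mul (H.mul (H.inv p.1.2.1) (H.mul p.1.2.1 (x.ψ.arr g₂))) (H.inv q.1.2.1) := by
            rw [H.assoc (H.tgt_inv _) a₁]
        _ = H.mul (H.mul (H.inv p.1.2.1) (H.mul (y.ψ.arr g₁) q.1.2.1)) (H.inv q.1.2.1) := by
            rw [h]
        _ = H.mul (H.inv p.1.2.1) (H.mul (H.mul (y.ψ.arr g₁) q.1.2.1) (H.inv q.1.2.1)) := by
            rw [H.assoc]
            · rw [H.tgt_inv, H.src_mul a₂, b₃]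
            · rw [H.tgt_mul a₂, H.src_inv]
        _ = H.mul (H.inv p.1.2.1) (y.ψ.arr g₁) := by
            rw [H.assoc a₂ (H.src_inv _).symm, H.mul_inv, H.mul_one a₂]
    have n := α.natural ⟨(p.1.2.2, H.inv p.1.2.1, p.1.1), inv_mem_fiberObj p⟩
      ⟨(q.1.2.2, H.inv q.1.2.1, q.1.1), inv_mem_fiberObj q⟩ g₂ g₁ hs₂ ht₂ hs₁ ht₁ h'
    have sp := α.src_eq ⟨(p.1.2.2, H.inv p.1.2.1, p.1.1), inv_mem_fiberObj p⟩
    have tp := α.tgt_eq ⟨(p.1.2.2, H.inv p.1.2.1, p.1.1), inv_mem_fiberObj p⟩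
    have sq := α.src_eq ⟨(q.1.2.2, H.inv q.1.2.1, q.1.1), inv_mem_fiberObj q⟩
    have tq := α.tgt_eq ⟨(q.1.2.2, H.inv q.1.2.1, q.1.1), inv_mem_fiberObj q⟩
    revert n sp tp sq tq
    generalize α.toFun ⟨(p.1.2.2, H.inv p.1.2.1, p.1.1), inv_mem_fiberObj p⟩ = P
    generalize α.toFun ⟨(q.1.2.2, H.inv q.1.2.1, q.1.1), inv_mem_fiberObj q⟩ = Q
    intro n sp tp sq tq
    simp only at sp tp sq tq
    have c₁ : A.src (x.map.arr g₂) = A.src P := by rw [x.map.src_arr, hs₂, sp]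
    have c₂ : A.tgt (x.map.arr g₂) = A.src Q := by rw [x.map.tgt_arr, ht₂, sq]
    have c₃ : A.src (y.map.arr g₁) = A.tgt P := by rw [y.map.src_arr, hs₁, tp]
    have c₄ : A.tgt (y.map.arr g₁) = A.tgt Q := by rw [y.map.tgt_arr, ht₁, tq]
    have c₅ : A.tgt (A.inv P) = A.src (x.map.arr g₂) := by rw [A.tgt_inv, c₁]
    calc A.mul (A.inv P) (x.map.arr g₂)
        = A.mul (A.inv P) (A.mul (x.map.arr g₂) (A.mul Q (A.inv Q))) := by
          rw [A.mul_inv, A.mul_one c₂]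
      _ = A.mul (A.inv P) (A.mul (A.mul (x.map.arr g₂) Q) (A.inv Q)) := by
          rw [A.assoc c₂ (A.src_inv _).symm]
      _ = A.mul (A.inv P) (A.mul (A.mul P (y.map.arr g₁)) (A.inv Q)) := by rw [n]
      _ = A.mul (A.inv P) (A.mul P (A.mul (y.map.arr g₁) (A.inv Q))) := by
          rw [A.assoc c₃.symm (c₄.trans (A.src_inv _).symm)]
      _ = A.mul (A.mul (A.inv P) P) (A.mul (y.map.arr g₁) (A.inv Q)) := by
          rw [A.assoc (A.tgt_inv _)]
          rw [A.src_mul (c₄.trans (A.src_inv _).symm), c₃]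
      _ = A.mul (y.map.arr g₁) (A.inv Q) := by
          rw [A.inv_mul, A.one_mul]
          rw [A.src_mul (c₄.trans (A.src_inv _).symm), c₃]

theorem factor_indep {x y z : GenMor H A} (α : Hom x y) (β : Hom y z)
    {p p' : x.U.Obj × H.Arr × y.U.Obj} {q q' : y.U.Obj × H.Arr × z.U.Obj}
    (hp : p ∈ x.fiberObj y) (hp' : p' ∈ x.fiberObj y) (hq : q ∈ y.fiberObj z)
    (hq' : q' ∈ y.fiberObj z) (e : p.2.2 = q.1) (e' : p'.2.2 = q'.1) (e₁ : p.1 = p'.1)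
    (e₃ : q.2.2 = q'.2.2) (h : H.mul p.2.1 q.2.1 = H.mul p'.2.1 q'.2.1) :
    A.mul (α.toFun ⟨p, hp⟩) (β.toFun ⟨q, hq⟩) = A.mul (α.toFun ⟨p', hp'⟩) (β.toFun ⟨q', hq'⟩) := by
  obtain ⟨a₁, k, a₂⟩ := p
  obtain ⟨a₁', k', a₂'⟩ := p'
  obtain ⟨b₂, l, a₃⟩ := q
  obtain ⟨b₂', l', a₃'⟩ := q'
  simp only at e e' e₁ e₃ h
  subst e e' e₁ e₃
  have s₁ : H.src k = x.ψ.obj a₁ := hp.1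
  have t₁ : H.tgt k = y.ψ.obj a₂ := hp.2
  have s₁' : H.src k' = x.ψ.obj a₁ := hp'.1
  have t₁' : H.tgt k' = y.ψ.obj a₂' := hp'.2
  have s₂ : H.src l = y.ψ.obj a₂ := hq.1
  have t₂ : H.tgt l = z.ψ.obj a₃ := hq.2
  have s₂' : H.src l' = y.ψ.obj a₂' := hq'.1
  have t₂' : H.tgt l' = z.ψ.obj a₃ := hq'.2
  have i₁ : H.tgt (H.inv k) = H.src k' := by rw [H.tgt_inv, s₁, s₁']
  have hg : (a₂, H.mul (H.inv k) k', a₂') ∈ y.fiberObj y :=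
    ⟨by rw [H.src_mul i₁, H.src_inv, t₁], by rw [H.tgt_mul i₁, t₁']⟩
  have g₁ := y.src_lift ⟨_, hg⟩
  have g₂ := y.arr_lift ⟨_, hg⟩
  have g₃ := y.tgt_lift ⟨_, hg⟩
  revert g₁ g₂ g₃
  generalize y.lift ⟨(a₂, H.mul (H.inv k) k', a₂'), hg⟩ = g
  intro g₁ g₂ g₃
  simp only at g₁ g₂ g₃
  have m₁ : H.mul k (H.mul (H.inv k) k') = k' := by
    rw [← H.assoc (H.src_inv _).symm i₁, H.mul_inv, H.one_mul (by rw [s₁, s₁'])]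
  have j : H.tgt k' = H.src l' := by rw [t₁', s₂']
  have m₂ : H.mul (H.mul (H.inv k) k') l' = l := by
    rw [H.assoc i₁ j, ← h, ← H.assoc (H.tgt_inv _) (by rw [t₁, s₂]), H.inv_mul,
      H.one_mul (by rw [t₁, s₂])]
  have nα := α.natural ⟨_, hp⟩ ⟨_, hp'⟩ (x.U.one a₁) g (x.U.src_one _) (x.U.tgt_one _) g₁ g₃
    (by rw [x.ψ.arr_one, H.one_mul s₁', g₂, m₁])
  have nβ := β.natural ⟨_, hq⟩ ⟨_, hq'⟩ g (z.U.one a₃) g₁ g₃ (z.U.src_one _) (z.U.tgt_one _)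
    (by rw [z.ψ.arr_one, H.mul_one t₂, g₂, m₂])
  rw [x.map.arr_one, A.one_mul (x := x.map.obj a₁) (α.src_eq ⟨_, hp'⟩)] at nα
  rw [z.map.arr_one, A.mul_one (x := z.map.obj a₃) (β.tgt_eq ⟨_, hq⟩)] at nβ
  rw [← nα, nβ, A.assoc]
  · rw [α.tgt_eq, y.map.src_arr, g₁]
  · rw [y.map.tgt_arr, β.src_eq, g₃]

/-- An object of the middle groupoid and an arrow of `H` through which one may factor. -/
theorem exists_mid (x y : GenMor H A) (a : x.U.Obj) :
    ∃ q : y.U.Obj × H.Arr, H.src q.2 = y.ψ.obj q.1 ∧ H.tgt q.2 = x.ψ.obj a := by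
  obtain ⟨b, k, h⟩ := y.equivalence.surjective (x.ψ.obj a)
  exact ⟨(b, k), h⟩

theorem mid_left {x y : GenMor H A} {a : x.U.Obj} {b : y.U.Obj} {k : H.Arr}
    (h : H.src k = y.ψ.obj b ∧ H.tgt k = x.ψ.obj a) : (a, H.inv k, b) ∈ x.fiberObj y :=
  ⟨(H.src_inv _).trans h.2, (H.tgt_inv _).trans h.1⟩

theorem mid_right {x y z : GenMor H A} {a : x.U.Obj} {b : y.U.Obj} {k l : H.Arr} {c : z.U.Obj}
    (h : H.src k = y.ψ.obj b ∧ H.tgt k = x.ψ.obj a) (hp : (a, l, c) ∈ x.fiberObj z) :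
    (b, H.mul k l, c) ∈ y.fiberObj z := by
  have e : H.tgt k = H.src l := h.2.trans hp.1.symm
  exact ⟨(H.src_mul e).trans h.1, (H.tgt_mul e).trans hp.2⟩

theorem mid_mul {x y z : GenMor H A} {a : x.U.Obj} {b : y.U.Obj} {k l : H.Arr} {c : z.U.Obj}
    (h : H.src k = y.ψ.obj b ∧ H.tgt k = x.ψ.obj a) (hp : (a, l, c) ∈ x.fiberObj z) :
    H.mul (H.inv k) (H.mul k l) = l := by
  have e : H.tgt k = H.src l := h.2.trans hp.1.symm
  rw [← H.assoc (H.tgt_inv _) e, H.inv_mul, H.one_mul e.symm]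

/-- The composite of arrows of generalized morphisms: its value at `(a₁, h, a₃)` is
`α(a₁, k₁, a₂) · β(a₂, k₂, a₃)` for any `a₂` and any factorization `h = k₁ k₂` through `ψ₂(a₂)`. -/
noncomputable def compFun {x y z : GenMor H A} (α : Hom x y) (β : Hom y z) (p : x.fiberObj z) :
    A.Arr :=
  A.mul (α.toFun ⟨_, mid_left (exists_mid x y p.1.1).choose_spec⟩)
    (β.toFun ⟨_, mid_right (exists_mid x y p.1.1).choose_spec p.2⟩)

theorem compFun_eq {x y z : GenMor H A} (α : Hom x y) (β : Hom y z)
    {p : x.U.Obj × H.Arr × y.U.Obj} {q : y.U.Obj × H.Arr × z.U.Obj} (hp : p ∈ x.fiberObj y)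
    (hq : q ∈ y.fiberObj z) (e : p.2.2 = q.1) (r : x.fiberObj z) (h₁ : r.1.1 = p.1)
    (h₂ : r.1.2.1 = H.mul p.2.1 q.2.1) (h₃ : r.1.2.2 = q.2.2) :
    compFun α β r = A.mul (α.toFun ⟨p, hp⟩) (β.toFun ⟨q, hq⟩) := by
  refine factor_indep α β _ _ _ _ rfl e h₁ h₃ ?_
  rw [← h₂]
  exact mid_mul (exists_mid x y r.1.1).choose_spec r.2

theorem compFun_smooth {x y z : GenMor H A} (α : Hom x y) (β : Hom y z) :
    SmoothOnSubset ((𝓡 x.U.dimObj).prod ((𝓡 H.dimArr).prod (𝓡 z.U.dimObj))) (𝓡 A.dimArr)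
      (compFun α β) := by
  classical
  intro p
  obtain ⟨⟨b, k⟩, hk⟩ := exists_mid x y p.1.1
  obtain ⟨σ₁, σ₂, cσ₁, cσ₂, v₁, v₂, hσ⟩ := y.equivalence.exists_section b k hk.1
  have hk2 : H.tgt k = x.ψ.obj p.1.1 := hk.2
  rw [hk2] at cσ₁ cσ₂ v₁ v₂ hσ
  obtain ⟨Fα, hFα, sα⟩ := α.smooth ⟨_, mid_left hk⟩
  obtain ⟨Fβ, hFβ, sβ⟩ := β.smooth ⟨_, mid_right hk p.2⟩
  let M := x.U.Obj × H.Arr × z.U.Obj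
  let good : Set M := {q | H.src (σ₂ (x.ψ.obj q.1)) = y.ψ.obj (σ₁ (x.ψ.obj q.1)) ∧
    H.tgt (σ₂ (x.ψ.obj q.1)) = x.ψ.obj q.1}
  let T : Set M := x.fiberObj z ∩ good
  have hcψ : Filter.Tendsto (fun q : M => x.ψ.obj q.1) (𝓝 p.1) (𝓝 (x.ψ.obj p.1.1)) :=
    (x.ψ.smooth_obj.continuous.comp continuous_fst).continuousAt
  have hgood : good ∈ 𝓝 p.1 := hcψ.eventually hσ
  have hT : T ∈ 𝓝[x.fiberObj z] p.1 :=
    Filter.inter_mem self_mem_nhdsWithin (mem_nhdsWithin_of_mem_nhds hgood)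
  let L : M → x.U.Obj × H.Arr × y.U.Obj :=
    fun q => (q.1, H.inv (σ₂ (x.ψ.obj q.1)), σ₁ (x.ψ.obj q.1))
  let R : M → y.U.Obj × H.Arr × z.U.Obj :=
    fun q => (σ₁ (x.ψ.obj q.1), H.mul (σ₂ (x.ψ.obj q.1)) q.2.1, q.2.2)
  have mL : ∀ q ∈ T, L q ∈ x.fiberObj y := fun q hq => mid_left hq.2
  have mR : ∀ q ∈ T, R q ∈ y.fiberObj z := fun q hq => mid_right hq.2 hq.1
  let G : M → A.Arr := fun q => A.mul (Fα (L q)) (Fβ (R q))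
  let F : M → A.Arr := fun q => if h : q ∈ x.fiberObj z then compFun α β ⟨q, h⟩ else
    compFun α β p
  have hF : ∀ q : x.fiberObj z, F q = compFun α β q := fun q => dif_pos q.2
  have hFG : ∀ q ∈ T, F q = G q := by
    intro q hq
    rw [hF ⟨q, hq.1⟩]
    change _ = A.mul (Fα (L q)) (Fβ (R q))
    rw [hFα ⟨_, mL q hq⟩, hFβ ⟨_, mR q hq⟩]
    exact compFun_eq α β (mL q hq) (mR q hq) rfl _ rfl (mid_mul hq.2 hq.1).symm rfl
  have hpT : p.1 ∈ T := mem_of_mem_nhdsWithin p.2 hT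
  have cψ : ContMDiffWithinAt ((𝓡 x.U.dimObj).prod ((𝓡 H.dimArr).prod (𝓡 z.U.dimObj)))
      (𝓡 H.dimObj) ∞ (fun q : M => x.ψ.obj q.1) T p.1 :=
    ((x.ψ.smooth_obj.comp contMDiff_fst) _).contMDiffWithinAt
  have c₁ := cσ₁.comp_contMDiffWithinAt p.1 cψ
  have c₂ := cσ₂.comp_contMDiffWithinAt p.1 cψ
  have cL : ContMDiffWithinAt ((𝓡 x.U.dimObj).prod ((𝓡 H.dimArr).prod (𝓡 z.U.dimObj)))
      ((𝓡 x.U.dimObj).prod ((𝓡 H.dimArr).prod (𝓡 y.U.dimObj))) ∞ L T p.1 :=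
    contMDiffWithinAt_fst.prodMk
      (((H.smooth_inv _).comp_contMDiffWithinAt p.1 c₂).prodMk c₁)
  have c₃ : ContMDiffWithinAt ((𝓡 x.U.dimObj).prod ((𝓡 H.dimArr).prod (𝓡 z.U.dimObj)))
      (𝓡 H.dimArr) ∞ (fun q : M => H.mul (σ₂ (x.ψ.obj q.1)) q.2.1) T p.1 := by
    refine ContMDiffWithinAt.comp p.1 (g := fun r : H.Arr × H.Arr => H.mul r.1 r.2)
      (f := fun q : M => (σ₂ (x.ψ.obj q.1), q.2.1))
      (t := {r : H.Arr × H.Arr | H.tgt r.1 = H.src r.2}) (H.smooth_mul _ ?_)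
      (c₂.prodMk (contMDiff_fst.comp contMDiff_snd _).contMDiffWithinAt) ?_
    · exact hpT.2.2.trans hpT.1.1.symm
    · exact fun q hq => hq.2.2.trans hq.1.1.symm
  have cR : ContMDiffWithinAt ((𝓡 x.U.dimObj).prod ((𝓡 H.dimArr).prod (𝓡 z.U.dimObj)))
      ((𝓡 y.U.dimObj).prod ((𝓡 H.dimArr).prod (𝓡 z.U.dimObj))) ∞ R T p.1 :=
    c₁.prodMk (c₃.prodMk (contMDiff_snd.comp contMDiff_snd _).contMDiffWithinAt)
  have vL : L p.1 = (p.1.1, H.inv k, b) := by simp only [L, v₁, v₂]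
  have vR : R p.1 = (b, H.mul k p.1.2.1, p.1.2.2) := by simp only [R, v₁, v₂]
  have dα := ContMDiffWithinAt.comp p.1 (g := Fα) (f := L) (by rw [vL]; exact sα) cL mL
  have dβ := ContMDiffWithinAt.comp p.1 (g := Fβ) (f := R) (by rw [vR]; exact sβ) cR mR
  have cG : ContMDiffWithinAt ((𝓡 x.U.dimObj).prod ((𝓡 H.dimArr).prod (𝓡 z.U.dimObj)))
      (𝓡 A.dimArr) ∞ G T p.1 := by
    have key : ∀ q ∈ T, A.tgt (Fα (L q)) = A.src (Fβ (R q)) := by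
      intro q hq
      rw [hFα ⟨_, mL q hq⟩, hFβ ⟨_, mR q hq⟩, α.tgt_eq, β.src_eq]
    exact ContMDiffWithinAt.comp p.1 (g := fun r : A.Arr × A.Arr => A.mul r.1 r.2)
      (f := fun q : M => (Fα (L q), Fβ (R q)))
      (t := {r : A.Arr × A.Arr | A.tgt r.1 = A.src r.2})
      (A.smooth_mul _ (key _ hpT)) (dα.prodMk dβ) key
  exact ⟨F, hF, (cG.congr hFG (hFG _ hpT)).mono_of_mem_nhdsWithin hT⟩

/-- The (vertical) composition of arrows of generalized morphisms. -/
noncomputable def Hom.comp {x y z : GenMor H A} (α : Hom x y) (β : Hom y z) : Hom x z where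
  toFun := compFun α β
  smooth := compFun_smooth α β
  src_eq p := by
    unfold compFun
    rw [A.src_mul (by rw [α.tgt_eq, β.src_eq]), α.src_eq]
  tgt_eq p := by
    unfold compFun
    rw [A.tgt_mul (by rw [α.tgt_eq, β.src_eq]), β.tgt_eq]
  natural p q g₁ g₃ hs₁ ht₁ hs₃ ht₃ h := by
    obtain ⟨⟨b, k⟩, hk⟩ := exists_mid x y p.1.1
    have tk : H.tgt k = x.ψ.obj p.1.1 := hk.2
    have i : H.tgt k = H.src (x.ψ.arr g₁) := by rw [tk, x.ψ.src_arr, hs₁]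
    have hk' : H.src (H.mul k (x.ψ.arr g₁)) = y.ψ.obj b ∧
        H.tgt (H.mul k (x.ψ.arr g₁)) = x.ψ.obj q.1.1 :=
      ⟨by rw [H.src_mul i]; exact hk.1, by rw [H.tgt_mul i, x.ψ.tgt_arr, ht₁]⟩
    rw [compFun_eq α β (mid_left hk) (mid_right hk p.2) rfl p rfl (mid_mul hk p.2).symm rfl,
      compFun_eq α β (mid_left hk') (mid_right hk' q.2) rfl q rfl (mid_mul hk' q.2).symm rfl]
    have j₁ : H.tgt k = H.src p.1.2.1 := by rw [tk]; exact p.2.1.symm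
    have j₂ : H.tgt (x.ψ.arr g₁) = H.src q.1.2.1 := by
      rw [x.ψ.tgt_arr, ht₁]; exact q.2.1.symm
    have j₃ : H.tgt p.1.2.1 = H.src (z.ψ.arr g₃) := by
      rw [z.ψ.src_arr, hs₃]; exact p.2.2
    have sb : H.src k = y.ψ.obj b := hk.1
    have nα := α.natural ⟨_, mid_left hk⟩ ⟨_, mid_left hk'⟩ g₁ (y.U.one b) hs₁ ht₁
      (y.U.src_one _) (y.U.tgt_one _) (by
        change H.mul (x.ψ.arr g₁) (H.inv (H.mul k (x.ψ.arr g₁))) =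
          H.mul (H.inv k) (y.ψ.arr (y.U.one b))
        rw [y.ψ.arr_one, H.mul_one ((H.tgt_inv _).trans sb)]
        have r₁ : H.src (x.ψ.arr g₁) = H.tgt k := i.symm
        have r₂ : H.src (H.inv (H.mul k (x.ψ.arr g₁))) = H.tgt (x.ψ.arr g₁) := by
          rw [H.src_inv, H.tgt_mul i]
        calc H.mul (x.ψ.arr g₁) (H.inv (H.mul k (x.ψ.arr g₁)))
            = H.mul (H.mul (H.mul (H.inv k) k) (x.ψ.arr g₁))
                (H.inv (H.mul k (x.ψ.arr g₁))) := by rw [H.inv_mul, H.one_mul r₁]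
          _ = H.mul (H.inv k) (H.mul (H.mul k (x.ψ.arr g₁))
                (H.inv (H.mul k (x.ψ.arr g₁)))) := by
              rw [H.assoc (H.tgt_inv _) i, H.assoc]
              · rw [H.tgt_inv, H.src_mul i]
              · rw [H.tgt_mul i, r₂]
          _ = H.inv k := by
              rw [H.mul_inv, H.mul_one]
              rw [H.tgt_inv, H.src_mul i])
    have nβ := β.natural ⟨_, mid_right hk p.2⟩ ⟨_, mid_right hk' q.2⟩ (y.U.one b) g₃
      (y.U.src_one _) (y.U.tgt_one _) hs₃ ht₃ (by
        change H.mul (y.ψ.arr (y.U.one b)) (H.mul (H.mul k (x.ψ.arr g₁)) q.1.2.1) =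
          H.mul (H.mul k p.1.2.1) (z.ψ.arr g₃)
        rw [y.ψ.arr_one, H.assoc i j₂, h, H.one_mul, H.assoc j₁ j₃]
        rw [H.src_mul, sb]
        rw [H.src_mul j₃, j₁])
    rw [y.map.arr_one, A.mul_one (α.tgt_eq _)] at nα
    rw [y.map.arr_one, A.one_mul (x := y.map.obj b) (β.src_eq ⟨_, mid_right hk' q.2⟩)] at nβ
    rw [A.assoc, nβ, nα, A.assoc]
    · rw [x.map.tgt_arr, α.src_eq, ht₁]
    · rw [α.tgt_eq, β.src_eq]
    · rw [α.tgt_eq, β.src_eq]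
    · rw [β.tgt_eq, z.map.src_arr, hs₃]

theorem Hom.id_comp {x y : GenMor H A} (α : Hom x y) : (Hom.id x).comp α = α := by
  refine Hom.ext (funext fun p => ?_)
  have h₁ : (p.1.1, H.one (x.ψ.obj p.1.1), p.1.1) ∈ x.fiberObj x :=
    ⟨H.src_one _, H.tgt_one _⟩
  have e := compFun_eq (Hom.id x) α h₁ p.2 rfl p rfl (H.one_mul p.2.1).symm rfl
  have hl : x.lift ⟨_, h₁⟩ = x.U.one p.1.1 := by
    refine x.equivalence.eq_of_arr_eq ?_ ?_ ?_
    · rw [x.src_lift, x.U.src_one]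
    · rw [x.tgt_lift, x.U.tgt_one]
    · rw [x.arr_lift, x.ψ.arr_one]
  refine e.trans ?_
  change A.mul (x.map.arr (x.lift ⟨_, h₁⟩)) _ = _
  rw [hl, x.map.arr_one, A.one_mul (α.src_eq _)]

theorem Hom.comp_id {x y : GenMor H A} (α : Hom x y) : α.comp (Hom.id y) = α := by
  refine Hom.ext (funext fun p => ?_)
  have h₁ : (p.1.2.2, H.one (y.ψ.obj p.1.2.2), p.1.2.2) ∈ y.fiberObj y :=
    ⟨H.src_one _, H.tgt_one _⟩
  have e := compFun_eq α (Hom.id y) p.2 h₁ rfl p rfl (H.mul_one p.2.2).symm rfl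
  have hl : y.lift ⟨_, h₁⟩ = y.U.one p.1.2.2 := by
    refine y.equivalence.eq_of_arr_eq ?_ ?_ ?_
    · rw [y.src_lift, y.U.src_one]
    · rw [y.tgt_lift, y.U.tgt_one]
    · rw [y.arr_lift, y.ψ.arr_one]
  refine e.trans ?_
  change A.mul _ (y.map.arr (y.lift ⟨_, h₁⟩)) = _
  rw [hl, y.map.arr_one, A.mul_one (α.tgt_eq _)]

theorem Hom.comp_assoc {w x y z : GenMor H A} (α : Hom w x) (β : Hom x y) (γ : Hom y z) :
    (α.comp β).comp γ = α.comp (β.comp γ) := by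
  refine Hom.ext (funext fun p => ?_)
  obtain ⟨⟨b, k⟩, hk⟩ := exists_mid w x p.1.1
  obtain ⟨⟨c, l⟩, hl⟩ := exists_mid w y p.1.1
  have k₁ : H.src k = x.ψ.obj b := hk.1
  have k₂ : H.tgt k = w.ψ.obj p.1.1 := hk.2
  have l₁ : H.src l = y.ψ.obj c := hl.1
  have l₂ : H.tgt l = w.ψ.obj p.1.1 := hl.2
  have i : H.tgt k = H.src (H.inv l) := by rw [H.src_inv, k₂, l₂]
  have hm : (b, H.mul k (H.inv l), c) ∈ x.fiberObj y :=
    ⟨by rw [H.src_mul i, k₁], by rw [H.tgt_mul i, H.tgt_inv, l₁]⟩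
  have j : H.tgt l = H.src p.1.2.1 := by rw [l₂]; exact p.2.1.symm
  have e₁ := compFun_eq (α.comp β) γ (mid_left hl) (mid_right hl p.2) rfl p rfl
    (mid_mul hl p.2).symm rfl
  have e₂ := compFun_eq α β (mid_left hk) hm rfl ⟨_, mid_left hl⟩ rfl (by
    change H.inv l = H.mul (H.inv k) (H.mul k (H.inv l))
    rw [← H.assoc (H.tgt_inv _) i, H.inv_mul, H.one_mul i.symm]) rfl
  have e₃ := compFun_eq α (β.comp γ) (mid_left hk) (mid_right hk p.2) rfl p rfl
    (mid_mul hk p.2).symm rfl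
  have e₄ := compFun_eq β γ hm (mid_right hl p.2) rfl ⟨_, mid_right hk p.2⟩ rfl (by
    change H.mul k p.1.2.1 = H.mul (H.mul k (H.inv l)) (H.mul l p.1.2.1)
    rw [H.assoc i, ← H.assoc (H.tgt_inv _) j, H.inv_mul, H.one_mul j.symm]
    rw [H.src_mul j, H.tgt_inv]) rfl
  refine e₁.trans (Eq.trans ?_ e₃.symm)
  change A.mul (compFun α β _) _ = A.mul _ (compFun β γ _)
  rw [e₂, e₄, A.assoc]
  · rw [α.tgt_eq, β.src_eq]
  · rw [β.tgt_eq, γ.src_eq]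

theorem Hom.comp_inv {x y : GenMor H A} (α : Hom x y) : α.comp α.inv = Hom.id x := by
  refine Hom.ext (funext fun p => ?_)
  obtain ⟨⟨b, k⟩, hk⟩ := exists_mid x y p.1.1
  have j : H.tgt k = H.src p.1.2.1 := by
    have : H.tgt k = x.ψ.obj p.1.1 := hk.2
    rw [this]; exact p.2.1.symm
  have k₁ : H.src k = y.ψ.obj b := hk.1
  have e := compFun_eq α α.inv (mid_left hk) (mid_right hk p.2) rfl p rfl
    (mid_mul hk p.2).symm rfl
  refine e.trans ?_
  change A.mul _ (A.inv (α.toFun ⟨(p.1.2.2, H.inv (H.mul k p.1.2.1), b), _⟩)) =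
    x.map.arr (x.lift p)
  have n := α.natural ⟨_, mid_left hk⟩
    ⟨(p.1.2.2, H.inv (H.mul k p.1.2.1), b), inv_mem_fiberObj ⟨_, mid_right hk p.2⟩⟩
    (x.lift p) (y.U.one b) (x.src_lift p) (x.tgt_lift p) (y.U.src_one _) (y.U.tgt_one _) (by
      change H.mul (x.ψ.arr (x.lift p)) (H.inv (H.mul k p.1.2.1)) =
        H.mul (H.inv k) (y.ψ.arr (y.U.one b))
      rw [x.arr_lift, y.ψ.arr_one, H.mul_one ((H.tgt_inv _).trans k₁)]
      calc H.mul p.1.2.1 (H.inv (H.mul k p.1.2.1))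
          = H.mul (H.mul (H.mul (H.inv k) k) p.1.2.1) (H.inv (H.mul k p.1.2.1)) := by
            rw [H.inv_mul, H.one_mul j.symm]
        _ = H.mul (H.inv k) (H.mul (H.mul k p.1.2.1) (H.inv (H.mul k p.1.2.1))) := by
            rw [H.assoc (H.tgt_inv _) j, H.assoc]
            · rw [H.tgt_inv, H.src_mul j]
            · rw [H.src_inv]
        _ = H.inv k := by
            rw [H.mul_inv, H.mul_one]
            rw [H.tgt_inv, H.src_mul j])
  rw [y.map.arr_one, A.mul_one (α.tgt_eq _)] at n
  rw [n, A.assoc, A.mul_inv, A.mul_one]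
  · rw [x.map.tgt_arr, α.src_eq, x.tgt_lift]
  · rw [x.map.tgt_arr, α.src_eq, x.tgt_lift]
  · rw [A.src_inv]

theorem Hom.inv_inv {x y : GenMor H A} (α : Hom x y) : α.inv.inv = α := by
  refine Hom.ext (funext fun p => ?_)
  have hi : ∀ (G : Gpd.{u, u}) (g : G.Arr), G.inv (G.inv g) = g := fun G g => by
    rw [← G.mul_one (g := G.inv (G.inv g)) (x := G.tgt g) (by rw [G.tgt_inv, G.src_inv]),
      ← G.inv_mul, ← G.assoc (by rw [G.tgt_inv]) (G.tgt_inv _), G.inv_mul,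
      G.one_mul (G.tgt_inv _).symm]
  change A.inv (A.inv (α.toFun ⟨(p.1.1, H.inv (H.inv p.1.2.1), p.1.2.2), _⟩)) = _
  rw [hi]
  congr 1
  exact Subtype.ext (by simp only [hi])

theorem Hom.inv_comp {x y : GenMor H A} (α : Hom x y) : α.inv.comp α = Hom.id y := by
  have h := α.inv.comp_inv
  rwa [α.inv_inv] at h

/-- The generalized morphism `(U, ψ, f ∘ u)`. -/
abbrev postcomp (f : SMor A B) (x : GenMor H A) : GenMor H B where
  U := x.U
  ψ := x.ψ
  equivalence := x.equivalence
  map := f.comp x.map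

/-- The arrow `f ∘ α`. -/
def Hom.postcomp (f : SMor A B) {x y : GenMor H A} (α : Hom x y) :
    Hom (x.postcomp f) (y.postcomp f) where
  toFun := fun p : x.fiberObj y => f.arr (α.toFun p)
  smooth := fun p : x.fiberObj y => by
    obtain ⟨F, hF, hs⟩ := α.smooth p
    exact ⟨fun q => f.arr (F q), fun q => congrArg f.arr (hF q),
      ContMDiffAt.comp_contMDiffWithinAt (p : x.U.Obj × H.Arr × y.U.Obj) (g := f.arr) (f := F)
        (f.smooth_arr _) hs⟩
  src_eq := fun p : x.fiberObj y => (f.src_arr _).trans (congrArg f.obj (α.src_eq p))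
  tgt_eq := fun p : x.fiberObj y => (f.tgt_arr _).trans (congrArg f.obj (α.tgt_eq p))
  natural := fun (p q : x.fiberObj y) (g₁ : x.U.Arr) (g₂ : y.U.Arr) hs₁ ht₁ hs₂ ht₂ h => by
    have n := congrArg f.arr (α.natural p q g₁ g₂ hs₁ ht₁ hs₂ ht₂ h)
    have e₁ : A.tgt (α.toFun p) = A.src (y.map.arr g₂) := by
      rw [α.tgt_eq, y.map.src_arr]; exact congrArg y.map.obj hs₂.symm
    have e₂ : A.tgt (x.map.arr g₁) = A.src (α.toFun q) := by
      rw [α.src_eq, x.map.tgt_arr]; exact congrArg x.map.obj ht₁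
    rw [f.arr_mul _ _ e₁, f.arr_mul _ _ e₂] at n
    exact n

end GenMor

/-- The arrows of the morphism groupoid, with their sources and targets. -/
structure MorArr (H A : LieGroupoid.{u}) where
  src : GenMor H A
  tgt : GenMor H A
  hom : src.Hom tgt

open Classical in
/-- The composition of the morphism groupoid. -/
noncomputable def MorArr.mul {H A : LieGroupoid.{u}} (α β : MorArr H A) : MorArr H A :=
  if h : α.tgt = β.src then ⟨α.src, β.tgt, GenMor.Hom.comp α.hom (h ▸ β.hom)⟩ else α

theorem MorArr.mul_mk {H A : LieGroupoid.{u}} {x y z : GenMor H A} (α : x.Hom y) (β : y.Hom z) :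
    MorArr.mul ⟨x, y, α⟩ ⟨y, z, β⟩ = ⟨x, z, α.comp β⟩ := by
  simp [MorArr.mul]

/-- The morphism groupoid `Mor(H, A)`: objects are the generalized morphisms `H ⇀ A`. -/
noncomputable def Mor (H A : LieGroupoid.{u}) : Gpd.{u + 1, u + 1} where
  Obj := GenMor H A
  Arr := MorArr H A
  str :=
    { src := MorArr.src
      tgt := MorArr.tgt
      mul := MorArr.mul
      one := fun x => ⟨x, x, GenMor.Hom.id x⟩
      inv := fun α => ⟨α.tgt, α.src, α.hom.inv⟩ }
  isGroupoid := by
    refine ⟨fun _ => rfl, fun _ => rfl, ?_, ?_, fun _ => rfl, fun _ => rfl, ?_, ?_, ?_, ?_, ?_⟩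
    · rintro ⟨x, y, α⟩ ⟨y', z, β⟩ h
      obtain rfl : y = y' := h
      exact congrArg MorArr.src (MorArr.mul_mk α β)
    · rintro ⟨x, y, α⟩ ⟨y', z, β⟩ h
      obtain rfl : y = y' := h
      exact congrArg MorArr.tgt (MorArr.mul_mk α β)
    · rintro ⟨w, x, α⟩ ⟨x', y, β⟩ ⟨y', z, γ⟩ h h'
      obtain rfl : x = x' := h
      obtain rfl : y = y' := h'
      simp only [MorArr.mul_mk, GenMor.Hom.comp_assoc]
    · rintro ⟨x, y, α⟩
      simp only [MorArr.mul_mk, GenMor.Hom.id_comp]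
    · rintro ⟨x, y, α⟩
      simp only [MorArr.mul_mk, GenMor.Hom.comp_id]
    · rintro ⟨x, y, α⟩
      simp only [MorArr.mul_mk, GenMor.Hom.comp_inv]
    · rintro ⟨x, y, α⟩
      simp only [MorArr.mul_mk, GenMor.Hom.inv_comp]

/-! ### Homology classes and the subgroupoids `Mor(H, A)_β` -/

/-- Singular homology with integer coefficients. -/
noncomputable def Homology (n : ℕ) (X : Type u) [TopologicalSpace X] : ModuleCat.{u} ℤ :=
  ((AlgebraicTopology.singularHomologyFunctor (ModuleCat.{u} ℤ) n).obj
    (ModuleCat.of ℤ (ULift.{u} ℤ))).obj (TopCat.of X)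

/-- The map `f_*` induced on singular homology by a continuous map. -/
noncomputable def Homology.map (n : ℕ) {X Y : Type u} [TopologicalSpace X] [TopologicalSpace Y]
    (f : C(X, Y)) : Homology n X →ₗ[ℤ] Homology n Y :=
  (((AlgebraicTopology.singularHomologyFunctor (ModuleCat.{u} ℤ) n).obj
    (ModuleCat.of ℤ (ULift.{u} ℤ))).map (TopCat.ofHom f)).hom

section Degree

variable {H A K : LieGroupoid.{u}} {Λ : K.Arr → A.SAut} {Ω : K.Arr → K.Arr → A.Obj → A.Arr}

/-- The coarse space of `G = A ⋊_{Λ, Ω} K`; objects `A⁰ × K⁰` carry the product topology. -/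
abbrev IsLieGenCocycle.coarse (_ : IsLieGenCocycle A K Λ Ω) : Type u :=
  (semidirect A.toGpd K.toGpd (fun ξ => (Λ ξ).toAut) Ω).Coarse

/-- The map from the coarse space of `A` to that of `A ⋊ K` induced by the inclusion
`a ↦ (a, x)`, `α ↦ (α, 1_x)` of `A` as the fiber over the object `x` of `K`. -/
def IsLieGenCocycle.fiberIncl (h : IsLieGenCocycle A K Λ Ω) (x : K.Obj) :
    C(A.str.Coarse, h.coarse) where
  toFun := Quot.map (fun a => (a, x)) fun _ _ ⟨g, hs, ht⟩ =>
    ⟨(g, K.one x), Prod.ext hs (K.src_one x), Prod.ext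
      ((congrFun (congrArg Gpd.Hom.obj (h.isGenCocycle.aut_one x)) _).trans ht) (K.tgt_one x)⟩
  continuous_toFun :=
    continuous_quot_lift _ (continuous_quot_mk.comp (continuous_id.prodMk continuous_const))

/-- The classes `c` in the homology of the coarse space of `A` that are sent to the class `β` in
the homology of the coarse space of `A ⋊ K` by the inclusion of a fiber are the same for all
fibers. -/
def IsLieGenCocycle.FiberIndependent (h : IsLieGenCocycle A K Λ Ω) {n : ℕ}
    (β : Homology n h.coarse) : Prop :=
  ∀ (x y : K.Obj) (c : Homology n A.str.Coarse),
    Homology.map n (h.fiberIncl x) c = β ↔ Homology.map n (h.fiberIncl y) c = β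

/-- The generalized morphisms `(U, ψ, u)` from `H` to `A` of class `β`: the class
`u_* ψ_*⁻¹ [H]` in the homology of the coarse space of `A` is sent to `β` by the inclusions of
fibers. -/
def morClass (h : IsLieGenCocycle A K Λ Ω) {n : ℕ} (fund : Homology n H.str.Coarse)
    (β : Homology n h.coarse) : Set (Mor H A).Obj :=
  {o : GenMor H A | ∃ d : Homology n o.U.str.Coarse, Homology.map n o.ψ.coarse d = fund ∧
    ∀ x, Homology.map n (h.fiberIncl x) (Homology.map n o.map.coarse d) = β}

end Degree

/-!
Composition with a strict morphism `f : A → B` is a functor `f_* : Mor(H, A) → Mor(H, B)`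
(`Mor.postcomp`), strictly compatible with composites and identities, so automorphisms of `A` act on
`Mor(H, A)` by automorphisms. A smooth natural transformation `σ : f ⇒ g` induces a natural
transformation `f_* ⇒ g_*` (`Mor.whisker`), whose value at `(U, ψ, u)` sends `(a₁, h, a₂)` to
`f(u(l)) · σ(u(a₂))`, where `l : a₁ → a₂` lifts `h`. This assignment respects vertical composition
and composition with morphisms on either side. Both sides of the cocycle identity for `Mor(H, A)`
are therefore induced by transformations between endomorphisms of `A`, and these agree by the
cocycle identity for `(Λ, Ω)` (`IsLieGenCocycle.isGenCocycle_mor`).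

That a generalized cocycle `(Λ, Ω)` defines an extension is a statement about groupoids without
topology (`IsGenCocycle.isProductExtension_semidirect`). By naturality of `Ω` the product in `A ⋊ K`
is `(α, ξ)(β, η) = (α · Ω(ξ, η, t α) · Λ_{ξη}⁻¹ Λ_η β, ξη)`; in this form associativity reduces to
the cocycle identity, and inverses on one side suffice. The theorem thus applies both to `Mor(H, A)`
and to its full subgroupoids that the automorphisms preserve (`IsGenCocycle.restrict`).

The subgroupoid of class `β` is preserved because the arrows `(1_a, ξ)` of `A ⋊ K` show that
`Λ_ξ`, followed by the inclusion of the fiber over `t ξ`, is the inclusion of the fiber over `s ξ`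
on coarse spaces (`IsLieGenCocycle.fiberIncl_comp_coarse`). If `K⁰` is connected, it is path
connected, being a manifold, and a path in `K⁰` is a homotopy between the inclusions of fibers;
homotopy invariance of singular homology gives the independence of the fiber
(`IsLieGenCocycle.fiberIndependent_of_preconnectedSpace`).
-/

/-! ### Singular homology of coarse spaces -/

theorem Homology.map_comp (n : ℕ) {X Y Z : Type u} [TopologicalSpace X] [TopologicalSpace Y]
    [TopologicalSpace Z] (g : C(Y, Z)) (f : C(X, Y)) (c : Homology n X) :
    Homology.map n (g.comp f) c = Homology.map n g (Homology.map n f c) := by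
  unfold Homology.map
  rw [TopCat.ofHom_comp, CategoryTheory.Functor.map_comp, ModuleCat.hom_comp]
  rfl

theorem Homology.map_eq_of_homotopy (n : ℕ) {X Y : Type u} [TopologicalSpace X]
    [TopologicalSpace Y] {f g : C(X, Y)} (F : f.Homotopy g) :
    Homology.map n f = Homology.map n g := by
  have F' : TopCat.Homotopy (TopCat.ofHom f) (TopCat.ofHom g) := F
  exact congrArg ModuleCat.Hom.hom (F'.congr_homologyMap_singularChainComplexFunctor
    (ModuleCat.of ℤ (ULift.{u} ℤ)) n)

section Degree

variable {H A K : LieGroupoid.{u}} {Λ : K.Arr → A.SAut} {Ω : K.Arr → K.Arr → A.Obj → A.Arr}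

/-- A path from `x` to `y` in `K⁰` deforms the inclusion of the fiber over `x` into the inclusion
of the fiber over `y`. -/
noncomputable def IsLieGenCocycle.fiberInclHomotopy (h : IsLieGenCocycle A K Λ Ω) {x y : K.Obj}
    (γ : Path x y) : (h.fiberIncl x).Homotopy (h.fiberIncl y) :=
  -- The product of a quotient map with the unit interval is treated by currying: the homotopy is
  -- first a map from the quotient `Ā` to the space of paths in the coarse space of `A ⋊ K`.
  let toPath : A.Obj → C(unitInterval, h.coarse) := fun a =>
    ⟨fun t => Quot.mk _ (a, γ t),
      continuous_quot_mk.comp (continuous_const.prodMk γ.continuous)⟩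
  have toPath_eq : ∀ a b : A.Obj, (∃ g : A.Arr, A.src g = a ∧ A.tgt g = b) →
      toPath a = toPath b := fun a b ⟨g, hs, ht⟩ => ContinuousMap.ext fun t =>
    Quot.sound ⟨(g, K.one (γ t)), Prod.ext hs (K.src_one _), Prod.ext
      ((congrFun (congrArg Gpd.Hom.obj (h.isGenCocycle.aut_one (γ t))) _).trans ht)
      (K.tgt_one _)⟩
  have toPath_cont : Continuous toPath :=
    ContinuousMap.continuous_of_continuous_uncurry _ <| continuous_quot_mk.comp <|
      continuous_fst.prodMk (γ.continuous.comp continuous_snd)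
  let G : C(A.str.Coarse, C(unitInterval, h.coarse)) :=
    ⟨Quot.lift toPath toPath_eq, continuous_quot_lift _ toPath_cont⟩
  { toContinuousMap := G.uncurry.comp ContinuousMap.prodSwap
    map_zero_left := by
      rintro ⟨a⟩
      exact congrArg (fun k => Quot.mk _ (a, k)) γ.source
    map_one_left := by
      rintro ⟨a⟩
      exact congrArg (fun k => Quot.mk _ (a, k)) γ.target }

theorem IsLieGenCocycle.fiberIndependent_of_preconnectedSpace (h : IsLieGenCocycle A K Λ Ω)
    [PreconnectedSpace K.Obj] {n : ℕ} (β : Homology n h.coarse) : h.FiberIndependent β := by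
  intro x y c
  have : LocallyPathConnectedSpace K.Obj :=
    ChartedSpace.locallyPathConnectedSpace (EuclideanSpace ℝ (Fin K.dimObj)) K.Obj
  have : ConnectedSpace K.Obj := { toNonempty := ⟨x⟩ }
  have : PathConnectedSpace K.Obj := pathConnectedSpace_iff_connectedSpace.2 this
  obtain ⟨γ⟩ := PathConnectedSpace.joined x y
  rw [Homology.map_eq_of_homotopy n (h.fiberInclHomotopy γ)]

/-- The arrow `(1_a, ξ)` of `A ⋊ K` joins `(a, s ξ)` to `(Λ_ξ a, t ξ)`. -/
theorem IsLieGenCocycle.fiberIncl_comp_coarse (h : IsLieGenCocycle A K Λ Ω) (ξ : K.Arr) :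
    (h.fiberIncl (K.tgt ξ)).comp (Λ ξ).hom.coarse = h.fiberIncl (K.src ξ) := by
  refine ContinuousMap.ext ?_
  rintro ⟨a⟩
  refine (Quot.sound ⟨(A.one a, ξ), Prod.ext (A.src_one a) rfl, Prod.ext ?_ rfl⟩).symm
  exact congrArg (Λ ξ).hom.obj (A.tgt_one a)

theorem postcomp_mem_morClass_iff (h : IsLieGenCocycle A K Λ Ω) {n : ℕ}
    (fund : Homology n H.str.Coarse) {β : Homology n h.coarse} (hβ : h.FiberIndependent β)
    (ξ : K.Arr) (o : GenMor H A) :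
    o.postcomp (Λ ξ).hom ∈ morClass h fund β ↔ o ∈ morClass h fund β := by
  have hc : (o.postcomp (Λ ξ).hom).map.coarse = (Λ ξ).hom.coarse.comp o.map.coarse :=
    ContinuousMap.ext (by rintro ⟨a⟩; rfl)
  have key : ∀ d : Homology n o.U.str.Coarse,
      Homology.map n (h.fiberIncl (K.tgt ξ))
        (Homology.map n (o.postcomp (Λ ξ).hom).map.coarse d) =
      Homology.map n (h.fiberIncl (K.src ξ)) (Homology.map n o.map.coarse d) := fun d => by
    rw [hc, Homology.map_comp, ← Homology.map_comp n (h.fiberIncl (K.tgt ξ)),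
      h.fiberIncl_comp_coarse]
  constructor
  · rintro ⟨d, hd, hx⟩
    exact ⟨d, hd, fun x => (hβ _ x _).1 ((key d).symm.trans (hx _))⟩
  · rintro ⟨d, hd, hx⟩
    exact ⟨d, hd, fun x => (hβ _ x _).1 ((key d).trans (hx _))⟩

end Degree

/-! ### Groupoids, functors and strict automorphisms -/

namespace Gpd

theorem inv_mul_cancel_left (G : Gpd.{u, v}) {g h : G.Arr} (e : G.tgt g = G.src h) :
    G.mul (G.inv g) (G.mul g h) = h := by
  rw [← G.assoc (G.tgt_inv g) e, G.inv_mul, G.one_mul e.symm]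

theorem Hom.arr_inv {G : Gpd.{u, v}} {H : Gpd.{w, z}} (f : Hom G H) (g : G.Arr) :
    f.arr (G.inv g) = H.inv (f.arr g) := by
  have h := H.inv_mul_cancel_left (g := f.arr g) (h := f.arr (G.inv g))
    (by rw [f.tgt_arr, f.src_arr, G.src_inv])
  rw [← f.arr_mul _ _ (G.src_inv g).symm, G.mul_inv, f.arr_one] at h
  rw [← h, H.mul_one (by rw [H.tgt_inv, f.src_arr])]

variable {G : Gpd.{u, v}} (φ : G.Aut)

@[simp] theorem Aut.hom_inv_obj (x : G.Obj) : φ.hom.obj (φ.inv.obj x) = x :=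
  congrFun (congrArg Hom.obj φ.hom_inv) x

@[simp] theorem Aut.inv_hom_obj (x : G.Obj) : φ.inv.obj (φ.hom.obj x) = x :=
  congrFun (congrArg Hom.obj φ.inv_hom) x

@[simp] theorem Aut.hom_inv_arr (g : G.Arr) : φ.hom.arr (φ.inv.arr g) = g :=
  congrFun (congrArg Hom.arr φ.hom_inv) g

@[simp] theorem Aut.inv_hom_arr (g : G.Arr) : φ.inv.arr (φ.hom.arr g) = g :=
  congrFun (congrArg Hom.arr φ.inv_hom) g

end Gpd

/-- In a category, right inverses of all arrows are inverses. -/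
theorem GroupoidData.isGroupoid_of_mul_inv {O : Type u} {R : Type v} (D : GroupoidData O R)
    (src_one : ∀ x, D.src (D.one x) = x) (tgt_one : ∀ x, D.tgt (D.one x) = x)
    (src_mul : ∀ g h, D.tgt g = D.src h → D.src (D.mul g h) = D.src g)
    (tgt_mul : ∀ g h, D.tgt g = D.src h → D.tgt (D.mul g h) = D.tgt h)
    (src_inv : ∀ g, D.src (D.inv g) = D.tgt g) (tgt_inv : ∀ g, D.tgt (D.inv g) = D.src g)
    (assoc : ∀ g h k, D.tgt g = D.src h → D.tgt h = D.src k →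
      D.mul (D.mul g h) k = D.mul g (D.mul h k))
    (one_mul : ∀ g, D.mul (D.one (D.src g)) g = g) (mul_one : ∀ g, D.mul g (D.one (D.tgt g)) = g)
    (mul_inv : ∀ g, D.mul g (D.inv g) = D.one (D.src g)) : D.IsGroupoid := by
  refine ⟨src_one, tgt_one, src_mul, tgt_mul, src_inv, tgt_inv, assoc, one_mul, mul_one, mul_inv,
    fun g => ?_⟩
  have h : D.inv (D.inv g) = g := by
    have h₁ := assoc g (D.inv g) (D.inv (D.inv g)) (src_inv g).symm (src_inv _).symm
    rw [mul_inv, mul_inv, src_inv, mul_one] at h₁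
    have h₂ := one_mul (D.inv (D.inv g))
    rw [src_inv, tgt_inv] at h₂
    exact h₂.symm.trans h₁
  have h₁ := mul_inv (D.inv g)
  rwa [h, src_inv] at h₁

/-! ### The extension defined by a generalized cocycle -/

namespace IsGenCocycle

variable {A : Gpd.{u, v}} {K : Gpd.{w, z}} {Λ : K.Arr → A.Aut} {Ω : K.Arr → K.Arr → A.Obj → A.Arr}

theorem hom_one_obj (hc : IsGenCocycle A K Λ Ω) (x : K.Obj) (a : A.Obj)
    : (Λ (K.one x)).hom.obj a = a :=
  congrFun (congrArg Gpd.Hom.obj (hc.aut_one x)) a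

theorem hom_one_arr (hc : IsGenCocycle A K Λ Ω) (x : K.Obj) (α : A.Arr)
    : (Λ (K.one x)).hom.arr α = α :=
  congrFun (congrArg Gpd.Hom.arr (hc.aut_one x)) α

theorem inv_one_obj (hc : IsGenCocycle A K Λ Ω) (x : K.Obj) (a : A.Obj)
    : (Λ (K.one x)).inv.obj a = a := by
  have h := (Λ (K.one x)).inv_hom_obj a
  rwa [hc.hom_one_obj] at h

theorem inv_one_arr (hc : IsGenCocycle A K Λ Ω) (x : K.Obj) (α : A.Arr)
    : (Λ (K.one x)).inv.arr α = α := by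
  have h := (Λ (K.one x)).inv_hom_arr α
  rwa [hc.hom_one_arr] at h

theorem src_Ω (hc : IsGenCocycle A K Λ Ω) {ξ η : K.Arr} (e : K.tgt ξ = K.src η) (a : A.Obj)
    : A.src (Ω ξ η a) = a :=
  (hc.natTrans ξ η e).src_eq a

theorem tgt_Ω (hc : IsGenCocycle A K Λ Ω) {ξ η : K.Arr} (e : K.tgt ξ = K.src η) (a : A.Obj) :
    A.tgt (Ω ξ η a) =
      (Λ (K.mul ξ η)).inv.obj ((Λ η).hom.obj ((Λ ξ).hom.obj a)) :=
  (hc.natTrans ξ η e).tgt_eq a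

theorem naturality (hc : IsGenCocycle A K Λ Ω) {ξ η : K.Arr} (e : K.tgt ξ = K.src η) (α : A.Arr) :
    A.mul (Ω ξ η (A.src α)) ((Λ (K.mul ξ η)).inv.arr ((Λ η).hom.arr ((Λ ξ).hom.arr α))) =
      A.mul α (Ω ξ η (A.tgt α)) :=
  (hc.natTrans ξ η e).natural α

/-- By naturality of `Ω`, the product of `(α, ξ)` and `(β, η)` has first component
`α · Ω(ξ, η, t α) · Λ_{ξη}⁻¹ Λ_η β`. -/
theorem semidirect_mul (hc : IsGenCocycle A K Λ Ω) (g h : A.Arr × K.Arr)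
    (e : K.tgt g.2 = K.src h.2) :
    (semidirect A K Λ Ω).mul g h =
      (A.mul (A.mul g.1 (Ω g.2 h.2 (A.tgt g.1)))
        ((Λ (K.mul g.2 h.2)).inv.arr ((Λ h.2).hom.arr h.1)), K.mul g.2 h.2) :=
  congrArg (fun x => (A.mul x _, _)) (hc.naturality e g.1)

/-- The core of associativity in `A ⋊ K`. For `β = Λ_ξ β'`, naturality of `Ω(ξ, η)` and of
`Ω(ξ, ηζ)` moves `β'` to the left of both sides, and what remains is the cocycle identity at the
target of `β'`. -/
theorem mul_Ω_mul_Ω (hc : IsGenCocycle A K Λ Ω) {ξ η ζ : K.Arr} (e : K.tgt ξ = K.src η)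
    (e' : K.tgt η = K.src ζ) {a : A.Obj} {β : A.Arr} (hβ : A.src β = (Λ ξ).hom.obj a) :
    A.mul (A.mul (Ω ξ η a) ((Λ (K.mul ξ η)).inv.arr ((Λ η).hom.arr β)))
        (Ω (K.mul ξ η) ζ ((Λ (K.mul ξ η)).inv.obj ((Λ η).hom.obj (A.tgt β)))) =
      A.mul (Ω ξ (K.mul η ζ) a) ((Λ (K.mul ξ (K.mul η ζ))).inv.arr ((Λ (K.mul η ζ)).hom.arr
        (A.mul β (Ω η ζ (A.tgt β))))) := by
  obtain ⟨β, rfl⟩ : ∃ β', (Λ ξ).hom.arr β' = β := ⟨(Λ ξ).inv.arr β, by simp⟩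
  have ha : A.src β = a := by
    rw [(Λ ξ).hom.src_arr] at hβ
    simpa using congrArg (Λ ξ).inv.obj hβ
  have e₁ : K.tgt (K.mul ξ η) = K.src ζ := (K.tgt_mul e).trans e'
  have e₂ : K.tgt ξ = K.src (K.mul η ζ) := e.trans (K.src_mul e').symm
  have sΩ := hc.src_Ω e' ((Λ ξ).hom.obj (A.tgt β))
  have hτ : A.tgt β = A.src ((Λ ξ).inv.arr (Ω η ζ ((Λ ξ).hom.obj (A.tgt β)))) := by
    rw [(Λ ξ).inv.src_arr, sΩ, Gpd.Aut.inv_hom_obj]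
  have hβΩ : A.mul ((Λ ξ).hom.arr β) (Ω η ζ ((Λ ξ).hom.obj (A.tgt β))) =
      (Λ ξ).hom.arr (A.mul β ((Λ ξ).inv.arr (Ω η ζ ((Λ ξ).hom.obj (A.tgt β))))) := by
    rw [(Λ ξ).hom.arr_mul _ _ hτ, Gpd.Aut.hom_inv_arr]
  rw [(Λ ξ).hom.tgt_arr, hβΩ, ← ha, hc.naturality e]
  have hn := hc.naturality e₂ (A.mul β ((Λ ξ).inv.arr (Ω η ζ ((Λ ξ).hom.obj (A.tgt β)))))
  rw [A.src_mul hτ, A.tgt_mul hτ] at hn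
  rw [hn, A.assoc (hc.src_Ω e _).symm, hc.cocycle ξ η ζ e e', A.assoc hτ,
    (Λ ξ).inv.tgt_arr, hc.tgt_Ω e']
  · rw [hc.src_Ω e₂]
  · rw [hc.tgt_Ω e, hc.src_Ω e₁]

theorem semidirect_src_mul (hc : IsGenCocycle A K Λ Ω) (g h : A.Arr × K.Arr)
    (e : (semidirect A K Λ Ω).tgt g = (semidirect A K Λ Ω).src h) :
    (semidirect A K Λ Ω).src ((semidirect A K Λ Ω).mul g h) = (semidirect A K Λ Ω).src g := by
  have e₁ : (Λ g.2).hom.obj (A.tgt g.1) = A.src h.1 := congrArg Prod.fst e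
  have e₂ : K.tgt g.2 = K.src h.2 := congrArg Prod.snd e
  rw [hc.semidirect_mul g h e₂]
  have i := hc.src_Ω e₂ (A.tgt g.1)
  refine Prod.ext ?_ (K.src_mul e₂)
  change A.src (A.mul _ _) = A.src g.1
  rw [A.src_mul, A.src_mul i.symm]
  rw [A.tgt_mul i.symm, hc.tgt_Ω e₂, (Λ (K.mul g.2 h.2)).inv.src_arr, (Λ h.2).hom.src_arr, e₁]

theorem semidirect_tgt_mul (hc : IsGenCocycle A K Λ Ω) (g h : A.Arr × K.Arr)
    (e : (semidirect A K Λ Ω).tgt g = (semidirect A K Λ Ω).src h) :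
    (semidirect A K Λ Ω).tgt ((semidirect A K Λ Ω).mul g h) = (semidirect A K Λ Ω).tgt h := by
  have e₁ : (Λ g.2).hom.obj (A.tgt g.1) = A.src h.1 := congrArg Prod.fst e
  have e₂ : K.tgt g.2 = K.src h.2 := congrArg Prod.snd e
  rw [hc.semidirect_mul g h e₂]
  have i := hc.src_Ω e₂ (A.tgt g.1)
  refine Prod.ext ?_ (K.tgt_mul e₂)
  change (Λ (K.mul g.2 h.2)).hom.obj (A.tgt (A.mul _ _)) = (Λ h.2).hom.obj (A.tgt h.1)
  rw [A.tgt_mul, (Λ (K.mul g.2 h.2)).inv.tgt_arr, Gpd.Aut.hom_inv_obj, (Λ h.2).hom.tgt_arr]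
  rw [A.tgt_mul i.symm, hc.tgt_Ω e₂, (Λ (K.mul g.2 h.2)).inv.src_arr, (Λ h.2).hom.src_arr, e₁]

theorem semidirect_assoc (hc : IsGenCocycle A K Λ Ω) (g h k : A.Arr × K.Arr)
    (e : (semidirect A K Λ Ω).tgt g = (semidirect A K Λ Ω).src h)
    (e' : (semidirect A K Λ Ω).tgt h = (semidirect A K Λ Ω).src k) :
    (semidirect A K Λ Ω).mul ((semidirect A K Λ Ω).mul g h) k =
      (semidirect A K Λ Ω).mul g ((semidirect A K Λ Ω).mul h k) := by
  obtain ⟨α, ξ⟩ := g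
  obtain ⟨β, η⟩ := h
  obtain ⟨γ, ζ⟩ := k
  have e₁ : (Λ ξ).hom.obj (A.tgt α) = A.src β := congrArg Prod.fst e
  have e₂ : K.tgt ξ = K.src η := congrArg Prod.snd e
  have e₁' : (Λ η).hom.obj (A.tgt β) = A.src γ := congrArg Prod.fst e'
  have e₂' : K.tgt η = K.src ζ := congrArg Prod.snd e'
  have f₁ : K.tgt (K.mul ξ η) = K.src ζ := (K.tgt_mul e₂).trans e₂'
  have f₂ : K.tgt ξ = K.src (K.mul η ζ) := e₂.trans (K.src_mul e₂').symm
  have hK := K.assoc e₂ e₂'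
  rw [hc.semidirect_mul ((semidirect A K Λ Ω).mul (α, ξ) (β, η)) (γ, ζ) f₁,
    hc.semidirect_mul (α, ξ) ((semidirect A K Λ Ω).mul (β, η) (γ, ζ)) f₂,
    hc.semidirect_mul (α, ξ) (β, η) e₂, hc.semidirect_mul (β, η) (γ, ζ) e₂']
  refine Prod.ext ?_ hK
  simp only
  -- the composable string `α, Ω(ξ, η), Λ_{ξη}⁻¹ Λ_η β`
  have i₁ : A.tgt α = A.src (Ω ξ η (A.tgt α)) := (hc.src_Ω e₂ _).symm
  have i₂ : A.tgt (Ω ξ η (A.tgt α)) =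
      A.src ((Λ (K.mul ξ η)).inv.arr ((Λ η).hom.arr β)) := by
    rw [hc.tgt_Ω e₂, (Λ (K.mul ξ η)).inv.src_arr, (Λ η).hom.src_arr, e₁]
  have t₁ : A.tgt ((Λ (K.mul ξ η)).inv.arr ((Λ η).hom.arr β)) =
      (Λ (K.mul ξ η)).inv.obj ((Λ η).hom.obj (A.tgt β)) := by
    rw [(Λ (K.mul ξ η)).inv.tgt_arr, (Λ η).hom.tgt_arr]
  -- the composable string `β, Ω(η, ζ), Λ_{ηζ}⁻¹ Λ_ζ γ`
  have j₁ : A.tgt β = A.src (Ω η ζ (A.tgt β)) := (hc.src_Ω e₂' _).symm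
  have j₂ : A.tgt (Ω η ζ (A.tgt β)) =
      A.src ((Λ (K.mul η ζ)).inv.arr ((Λ ζ).hom.arr γ)) := by
    rw [hc.tgt_Ω e₂', (Λ (K.mul η ζ)).inv.src_arr, (Λ ζ).hom.src_arr, e₁']
  have j₃ : A.tgt (A.mul β (Ω η ζ (A.tgt β))) =
      A.src ((Λ (K.mul η ζ)).inv.arr ((Λ ζ).hom.arr γ)) := (A.tgt_mul j₁).trans j₂
  have i₃ := i₁.trans (A.src_mul i₂).symm
  have i₄ : A.tgt (A.mul (Ω ξ η (A.tgt α)) ((Λ (K.mul ξ η)).inv.arr ((Λ η).hom.arr β))) =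
      A.src (Ω (K.mul ξ η) ζ ((Λ (K.mul ξ η)).inv.obj ((Λ η).hom.obj (A.tgt β)))) := by
    rw [A.tgt_mul i₂, t₁, hc.src_Ω f₁]
  rw [A.assoc i₁ i₂, A.tgt_mul i₃, A.tgt_mul i₂, t₁, A.assoc i₃ i₄,
    hc.mul_Ω_mul_Ω e₂ e₂' e₁.symm]
  rw [(Λ (K.mul η ζ)).hom.arr_mul _ _ j₃, Gpd.Aut.hom_inv_arr,
    (Λ (K.mul ξ (K.mul η ζ))).inv.arr_mul, hK]
  · have k₁ : A.tgt α = A.src (Ω ξ (K.mul η ζ) (A.tgt α)) := (hc.src_Ω f₂ _).symm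
    have k₂ : A.tgt (Ω ξ (K.mul η ζ) (A.tgt α)) = A.src ((Λ (K.mul ξ (K.mul η ζ))).inv.arr
        ((Λ (K.mul η ζ)).hom.arr (A.mul β (Ω η ζ (A.tgt β))))) := by
      rw [hc.tgt_Ω f₂, (Λ (K.mul ξ (K.mul η ζ))).inv.src_arr, (Λ (K.mul η ζ)).hom.src_arr,
        A.src_mul j₁, e₁]
    rw [← A.assoc k₁ k₂, A.assoc ((A.tgt_mul k₁).trans k₂)]
    rw [(Λ (K.mul ξ (K.mul η ζ))).inv.tgt_arr, (Λ (K.mul η ζ)).hom.tgt_arr, j₃,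
      (Λ (K.mul η ζ)).inv.src_arr, Gpd.Aut.hom_inv_obj,
      (Λ (K.mul ξ (K.mul η ζ))).inv.src_arr, (Λ ζ).hom.src_arr]
  · rw [(Λ (K.mul η ζ)).hom.tgt_arr, j₃, (Λ (K.mul η ζ)).inv.src_arr, Gpd.Aut.hom_inv_obj]

theorem semidirect_mul_inv (hc : IsGenCocycle A K Λ Ω) (g : A.Arr × K.Arr) :
    (semidirect A K Λ Ω).mul g ((semidirect A K Λ Ω).inv g) =
      (semidirect A K Λ Ω).one ((semidirect A K Λ Ω).src g) := by
  obtain ⟨α, ξ⟩ := g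
  have e : K.tgt ξ = K.src (K.inv ξ) := (K.src_inv ξ).symm
  have sΩ := hc.src_Ω e (A.src α)
  have tΩ := hc.tgt_Ω e (A.src α)
  have hn := hc.naturality e α
  refine Prod.ext ?_ (K.mul_inv ξ)
  change A.mul (A.mul (Ω ξ (K.inv ξ) (A.src α)) ((Λ (K.mul ξ (K.inv ξ))).inv.arr
      ((Λ (K.inv ξ)).hom.arr ((Λ ξ).hom.arr α)))) ((Λ (K.mul ξ (K.inv ξ))).inv.arr
      ((Λ (K.inv ξ)).hom.arr (A.mul ((Λ ξ).hom.arr (A.inv α))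
        ((Λ (K.inv ξ)).inv.arr (A.inv (Ω ξ (K.inv ξ) (A.src α))))))) = A.one (A.src α)
  rw [K.mul_inv] at tΩ ⊢
  rw [hc.inv_one_obj] at tΩ
  rw [hc.inv_one_arr, hc.inv_one_arr, (Λ ξ).hom.arr_inv, (Λ (K.inv ξ)).hom.arr_mul,
    (Λ (K.inv ξ)).hom.arr_inv, Gpd.Aut.hom_inv_arr]
  · generalize hX : (Λ (K.inv ξ)).hom.arr ((Λ ξ).hom.arr α) = X
    have sX : A.src X = A.tgt (Ω ξ (K.inv ξ) (A.src α)) := by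
      rw [← hX, tΩ, (Λ (K.inv ξ)).hom.src_arr, (Λ ξ).hom.src_arr]
    have t₁ : A.tgt (A.inv X) = A.src (A.inv (Ω ξ (K.inv ξ) (A.src α))) := by
      rw [A.tgt_inv, A.src_inv, sX]
    rw [A.assoc sX.symm (by rw [A.src_mul t₁, A.src_inv]),
      ← A.assoc (A.src_inv X).symm t₁, A.mul_inv, A.one_mul (by rw [A.src_inv, sX]), A.mul_inv,
      sΩ]
  · rw [A.tgt_inv, (Λ ξ).hom.src_arr, (Λ (K.inv ξ)).inv.src_arr, A.src_inv, tΩ,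
      Gpd.Aut.inv_hom_obj]

theorem semidirect_isGroupoid (hc : IsGenCocycle A K Λ Ω) :
    (semidirect A K Λ Ω).IsGroupoid := by
  have src_inv : ∀ g, (semidirect A K Λ Ω).src ((semidirect A K Λ Ω).inv g) =
        (semidirect A K Λ Ω).tgt g ∧
      (semidirect A K Λ Ω).tgt ((semidirect A K Λ Ω).inv g) = (semidirect A K Λ Ω).src g := by
    rintro ⟨α, ξ⟩
    have e : K.tgt ξ = K.src (K.inv ξ) := (K.src_inv ξ).symm
    have sΩ := hc.src_Ω e (A.src α)
    have tΩ := hc.tgt_Ω e (A.src α)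
    rw [K.mul_inv, hc.inv_one_obj] at tΩ
    have i : A.tgt ((Λ ξ).hom.arr (A.inv α)) =
        A.src ((Λ (K.inv ξ)).inv.arr (A.inv (Ω ξ (K.inv ξ) (A.src α)))) := by
      rw [(Λ ξ).hom.tgt_arr, A.tgt_inv, (Λ (K.inv ξ)).inv.src_arr, A.src_inv, tΩ,
        Gpd.Aut.inv_hom_obj]
    constructor
    · refine Prod.ext ((A.src_mul i).trans ?_) (K.src_inv ξ)
      rw [(Λ ξ).hom.src_arr, A.src_inv]
      rfl
    · refine Prod.ext ((congrArg (Λ (K.inv ξ)).hom.obj (A.tgt_mul i)).trans ?_) (K.tgt_inv ξ)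
      rw [(Λ (K.inv ξ)).inv.tgt_arr, Gpd.Aut.hom_inv_obj, A.tgt_inv, sΩ]
      rfl
  refine GroupoidData.isGroupoid_of_mul_inv _ ?_ ?_ hc.semidirect_src_mul hc.semidirect_tgt_mul
    (fun g => (src_inv g).1) (fun g => (src_inv g).2) hc.semidirect_assoc ?_ ?_
    hc.semidirect_mul_inv
  · exact fun x => Prod.ext (A.src_one _) (K.src_one _)
  · exact fun x => Prod.ext ((hc.hom_one_obj _ _).trans (A.tgt_one _)) (K.tgt_one _)
  · rintro ⟨α, ξ⟩
    refine Prod.ext ?_ (K.one_mul rfl)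
    change A.mul (A.mul (Ω (K.one (K.src ξ)) ξ (A.src (A.one (A.src α))))
      ((Λ (K.mul (K.one (K.src ξ)) ξ)).inv.arr ((Λ ξ).hom.arr
        ((Λ (K.one (K.src ξ))).hom.arr (A.one (A.src α))))))
      ((Λ (K.mul (K.one (K.src ξ)) ξ)).inv.arr ((Λ ξ).hom.arr α)) = α
    rw [hc.one_left, hc.hom_one_arr, K.one_mul rfl, Gpd.Aut.inv_hom_arr, Gpd.Aut.inv_hom_arr,
      A.src_one, A.one_mul (A.src_one _), A.one_mul rfl]
  · rintro ⟨α, ξ⟩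
    refine Prod.ext ?_ (K.mul_one rfl)
    change A.mul (A.mul (Ω ξ (K.one (K.tgt ξ)) (A.src α))
      ((Λ (K.mul ξ (K.one (K.tgt ξ)))).inv.arr ((Λ (K.one (K.tgt ξ))).hom.arr
        ((Λ ξ).hom.arr α))))
      ((Λ (K.mul ξ (K.one (K.tgt ξ)))).inv.arr ((Λ (K.one (K.tgt ξ))).hom.arr
        (A.one ((Λ ξ).hom.obj (A.tgt α))))) = α
    rw [hc.one_right, hc.hom_one_arr, hc.hom_one_arr, K.mul_one rfl, Gpd.Aut.inv_hom_arr,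
      A.one_mul rfl, (Λ ξ).inv.arr_one, Gpd.Aut.inv_hom_obj, A.mul_one rfl]

/-- A generalized cocycle `(Λ, Ω)` makes `A ⋊ K` an extension of `K` by `A` with pre-action map
`Λ` and cofactor `Ω`. -/
theorem isProductExtension_semidirect (hc : IsGenCocycle A K Λ Ω) :
    IsProductExtension A K Λ Ω (semidirect A K Λ Ω) := by
  set D := semidirect A K Λ Ω with hD
  have hG : D.IsGroupoid := hc.semidirect_isGroupoid
  let G : Gpd := ⟨_, _, D, hG⟩
  refine ⟨hG, fun _ _ => rfl, fun _ _ => rfl, fun _ => rfl, fun _ _ _ => rfl, ?_, ?_, ?_, ?_, ?_⟩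
  · exact fun α x => Prod.ext (hc.hom_one_obj _ _) (K.tgt_one _)
  · intro α β x h
    have hx : K.mul (K.one x) (K.one x) = K.one x := K.one_mul (K.src_one x)
    have e : K.tgt (K.one x) = K.src (K.one x) := by rw [K.tgt_one, K.src_one]
    have hΩ : Ω (K.one x) (K.one x) (A.tgt α) = A.one (A.tgt α) := by
      have := hc.one_left (K.one x) (A.tgt α)
      rwa [K.src_one] at this
    refine (hc.semidirect_mul (α, K.one x) (β, K.one x) e).trans ?_
    simp only [hx, hΩ, A.mul_one, hc.hom_one_arr, hc.inv_one_arr]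
  · exact fun a ξ => Prod.ext (congrArg (Λ ξ).hom.obj (A.tgt_one a)) rfl
  · intro α ξ
    have h₁ : D.mul (α, K.one (K.src ξ)) (A.one (A.tgt α), ξ) = (α, ξ) := by
      refine Prod.ext ?_ (K.one_mul rfl)
      change A.mul (A.mul (Ω (K.one (K.src ξ)) ξ (A.src α)) _) _ = α
      rw [hc.one_left, hc.hom_one_arr, K.one_mul rfl, Gpd.Aut.inv_hom_arr, Gpd.Aut.inv_hom_arr,
        A.one_mul rfl, A.mul_one rfl]
    have h₂ : D.mul (A.one (A.src α), ξ) ((Λ ξ).hom.arr α, K.one (K.tgt ξ)) = (α, ξ) := by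
      refine Prod.ext ?_ (K.mul_one rfl)
      change A.mul (A.mul (Ω ξ (K.one (K.tgt ξ)) (A.src (A.one (A.src α)))) _) _ = α
      rw [hc.one_right, hc.hom_one_arr, hc.hom_one_arr, K.mul_one rfl, Gpd.Aut.inv_hom_arr,
        Gpd.Aut.inv_hom_arr, A.src_one, A.one_mul (A.src_one _), A.one_mul rfl]
    have e : D.tgt (A.one (A.src α), ξ) = D.src ((Λ ξ).hom.arr α, K.one (K.tgt ξ)) :=
      Prod.ext ((congrArg (Λ ξ).hom.obj (A.tgt_one _)).trans ((Λ ξ).hom.src_arr α).symm)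
        (K.src_one _).symm
    rw [h₁, ← h₂]
    exact G.inv_mul_cancel_left e
  · intro ξ η e a
    have sΩ := hc.src_Ω e a
    have tΩ := hc.tgt_Ω e a
    have h₁ : D.mul (A.one a, ξ) (A.one ((Λ ξ).hom.obj a), η) = (Ω ξ η a, K.mul ξ η) := by
      refine Prod.ext ?_ rfl
      change A.mul (A.mul (Ω ξ η (A.src (A.one a))) _) _ = Ω ξ η a
      rw [(Λ ξ).hom.arr_one, (Λ η).hom.arr_one, (Λ (K.mul ξ η)).inv.arr_one, A.src_one,
        A.mul_one tΩ, A.mul_one tΩ]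
    have hρ : K.src (K.mul ξ η) = K.src ξ := K.src_mul e
    set a' := (Λ (K.mul ξ η)).inv.obj ((Λ η).hom.obj ((Λ ξ).hom.obj a)) with ha'
    have h₂ : D.mul (Ω ξ η a, K.one (K.src ξ)) (A.one a', K.mul ξ η) = (Ω ξ η a, K.mul ξ η) := by
      rw [← hρ]
      refine Prod.ext ?_ (K.one_mul rfl)
      change A.mul (A.mul (Ω (K.one (K.src (K.mul ξ η))) (K.mul ξ η) (A.src (Ω ξ η a))) _) _ = _
      rw [hc.one_left, hc.hom_one_arr, K.one_mul rfl, Gpd.Aut.inv_hom_arr, Gpd.Aut.inv_hom_arr,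
        A.one_mul rfl, A.mul_one tΩ]
    rw [h₁, ← h₂]
    have e₁ : D.tgt (Ω ξ η a, K.one (K.src ξ)) = D.src (A.one a', K.mul ξ η) :=
      Prod.ext ((hc.hom_one_obj _ _).trans (tΩ.trans (A.src_one a').symm))
        ((K.tgt_one _).trans hρ.symm)
    refine (hG.assoc _ _ _ e₁ (hG.src_inv _).symm).trans ?_
    rw [hG.mul_inv, ← e₁]
    exact hG.mul_one _

end IsGenCocycle

/-! ### Restriction of a generalized cocycle to a full subgroupoid -/

namespace Gpd

theorem restrict_mul_val {G : Gpd.{u, v}} {P : Set G.Obj} {g h : (G.restrict P).Arr}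
    (e : G.tgt g.1 = G.src h.1) : ((G.restrict P).mul g h).1 = G.mul g.1 h.1 :=
  congrArg Subtype.val (dif_pos e)

/-- The restriction of a functor that sends `P` to `P`. -/
noncomputable def Hom.restrict {G : Gpd.{u, v}} (f : Hom G G) (P : Set G.Obj)
    (hP : ∀ x ∈ P, f.obj x ∈ P) : Hom (G.restrict P) (G.restrict P) where
  obj x := ⟨f.obj x.1, hP _ x.2⟩
  arr g := ⟨f.arr g.1, by rw [f.src_arr]; exact hP _ g.2.1, by rw [f.tgt_arr]; exact hP _ g.2.2⟩
  src_arr g := Subtype.ext (f.src_arr g.1)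
  tgt_arr g := Subtype.ext (f.tgt_arr g.1)
  arr_one x := Subtype.ext (f.arr_one x.1)
  arr_mul g h e := by
    have e' : G.tgt g.1 = G.src h.1 := congrArg Subtype.val e
    refine Subtype.ext ?_
    rw [restrict_mul_val (g := ⟨f.arr g.1, _⟩) (h := ⟨f.arr h.1, _⟩)
      (by rw [f.tgt_arr, f.src_arr, e'])]
    exact (congrArg f.arr (restrict_mul_val e')).trans (f.arr_mul _ _ e')

/-- The restriction of an automorphism `φ` to a set `P` of objects with `φ⁻¹ P = P`. -/
noncomputable def Aut.restrict {G : Gpd.{u, v}} (φ : G.Aut) (P : Set G.Obj)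
    (hP : ∀ x, φ.hom.obj x ∈ P ↔ x ∈ P) : (G.restrict P).Aut where
  hom := φ.hom.restrict P fun x hx => (hP x).2 hx
  inv := φ.inv.restrict P fun x hx => (hP _).1 (by rwa [φ.hom_inv_obj])
  hom_inv := Hom.ext (funext fun x => Subtype.ext (φ.hom_inv_obj x.1))
    (funext fun g => Subtype.ext (φ.hom_inv_arr g.1))
  inv_hom := Hom.ext (funext fun x => Subtype.ext (φ.inv_hom_obj x.1))
    (funext fun g => Subtype.ext (φ.inv_hom_arr g.1))

end Gpd

namespace IsGenCocycle

variable {A : Gpd.{u, v}} {K : Gpd.{w, z}} {Λ : K.Arr → A.Aut} {Ω : K.Arr → K.Arr → A.Obj → A.Arr}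

open Classical in
/-- The restriction of the cofactor to a set `P` of objects that all `Λ_ξ` preserve. Its values at
pairs that are not composable are irrelevant; units are used there. -/
noncomputable def restrictΩ (hc : IsGenCocycle A K Λ Ω) (P : Set A.Obj)
    (hP : ∀ ξ a, (Λ ξ).hom.obj a ∈ P ↔ a ∈ P) (ξ η : K.Arr) (a : (A.restrict P).Obj) :
    (A.restrict P).Arr :=
  if e : K.tgt ξ = K.src η then
    ⟨Ω ξ η a.1, by rw [hc.src_Ω e]; exact a.2, by
      rw [hc.tgt_Ω e, ← hP (K.mul ξ η), Gpd.Aut.hom_inv_obj, hP, hP]; exact a.2⟩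
  else (A.restrict P).one a

theorem restrictΩ_val (hc : IsGenCocycle A K Λ Ω) (P : Set A.Obj)
    (hP : ∀ ξ a, (Λ ξ).hom.obj a ∈ P ↔ a ∈ P) {ξ η : K.Arr} (e : K.tgt ξ = K.src η)
    (a : (A.restrict P).Obj) : (hc.restrictΩ P hP ξ η a).1 = Ω ξ η a.1 :=
  congrArg Subtype.val (dif_pos e)

theorem restrict (hc : IsGenCocycle A K Λ Ω) (P : Set A.Obj)
    (hP : ∀ ξ a, (Λ ξ).hom.obj a ∈ P ↔ a ∈ P) :
    IsGenCocycle (A.restrict P) K (fun ξ => (Λ ξ).restrict P (hP ξ)) (hc.restrictΩ P hP) where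
  aut_one x := Gpd.Hom.ext (funext fun a => Subtype.ext (hc.hom_one_obj x a.1))
    (funext fun α => Subtype.ext (hc.hom_one_arr x α.1))
  natTrans ξ η e :=
    { src_eq := fun a => Subtype.ext <|
        (congrArg A.src (hc.restrictΩ_val P hP e a)).trans (hc.src_Ω e a.1)
      tgt_eq := fun a => Subtype.ext <|
        (congrArg A.tgt (hc.restrictΩ_val P hP e a)).trans (hc.tgt_Ω e a.1)
      natural := fun α => Subtype.ext <| by
        rw [Gpd.restrict_mul_val, Gpd.restrict_mul_val, hc.restrictΩ_val P hP e,
          hc.restrictΩ_val P hP e]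
        · exact hc.naturality e α.1
        · rw [hc.restrictΩ_val P hP e, hc.src_Ω e]; rfl
        · rw [hc.restrictΩ_val P hP e, hc.tgt_Ω e]
          exact (Gpd.Hom.src_arr ((Λ (K.mul ξ η)).inv.comp ((Λ η).hom.comp (Λ ξ).hom)) α.1).symm }
  one_left η a := Subtype.ext <|
    (hc.restrictΩ_val P hP (K.tgt_one _) a).trans (hc.one_left η a.1)
  one_right ξ a := Subtype.ext <|
    (hc.restrictΩ_val P hP (K.src_one _).symm a).trans (hc.one_right ξ a.1)
  cocycle ξ η ζ e e' a := Subtype.ext <| by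
    have e₁ : K.tgt (K.mul ξ η) = K.src ζ := (K.tgt_mul e).trans e'
    have e₂ : K.tgt ξ = K.src (K.mul η ζ) := e.trans (K.src_mul e').symm
    have h₁ := hc.restrictΩ_val P hP e a
    have h₂ := hc.restrictΩ_val P hP e₁
    have h₃ := hc.restrictΩ_val P hP e'
    have h₄ := hc.restrictΩ_val P hP e₂
    rw [Gpd.restrict_mul_val, Gpd.restrict_mul_val, h₁, h₂, h₄]
    · refine (hc.cocycle ξ η ζ e e' a.1).trans ?_
      exact congrArg (fun x => A.mul ((Λ ξ).inv.arr x) _)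
        (h₃ (((Λ ξ).restrict P (hP ξ)).hom.obj a)).symm
    · refine Eq.trans (congrArg (fun x => A.tgt ((Λ ξ).inv.arr x))
        (h₃ (((Λ ξ).restrict P (hP ξ)).hom.obj a))) ?_
      rw [h₄, (Λ ξ).inv.tgt_arr, hc.tgt_Ω e', hc.src_Ω e₂]
      rfl
    · rw [h₁, h₂, hc.tgt_Ω e, hc.src_Ω e₁]
      rfl

end IsGenCocycle

/-! ### Smooth natural transformations act on generalized morphisms -/

namespace SMor

variable {A B C : LieGroupoid.{u}}

theorem ext_toHom {f g : SMor A B} (h : f.toHom = g.toHom) : f = g := by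
  cases f
  cases g
  cases h
  rfl

/-- The identity morphism. -/
def id (A : LieGroupoid.{u}) : SMor A A where
  toHom := Gpd.Hom.id A.toGpd
  smooth_obj := contMDiff_id
  smooth_arr := contMDiff_id

/-- `σ` is a smooth natural transformation `f ⇒ g`. -/
structure IsSmoothNatTrans (f g : SMor A B) (σ : A.Obj → B.Arr) : Prop where
  isNatTrans : Gpd.IsNatTrans f.toHom g.toHom σ
  smooth : ContMDiff (𝓡 A.dimObj) (𝓡 B.dimArr) ∞ σ

namespace IsSmoothNatTrans

variable {f g k : SMor A B} {σ τ : A.Obj → B.Arr}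

theorem src_eq (h : IsSmoothNatTrans f g σ) (a : A.Obj) : B.src (σ a) = f.obj a :=
  h.isNatTrans.src_eq a

theorem tgt_eq (h : IsSmoothNatTrans f g σ) (a : A.Obj) : B.tgt (σ a) = g.obj a :=
  h.isNatTrans.tgt_eq a

theorem natural (h : IsSmoothNatTrans f g σ) (α : A.Arr) :
    B.mul (σ (A.src α)) (g.arr α) = B.mul (f.arr α) (σ (A.tgt α)) :=
  h.isNatTrans.natural α

/-- Vertical composition. -/
theorem vcomp (hσ : IsSmoothNatTrans f g σ) (hτ : IsSmoothNatTrans g k τ) :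
    IsSmoothNatTrans f k fun a => B.mul (σ a) (τ a) where
  isNatTrans :=
    { src_eq := fun a => by rw [B.src_mul (by rw [hσ.tgt_eq, hτ.src_eq]), hσ.src_eq]
      tgt_eq := fun a => by rw [B.tgt_mul (by rw [hσ.tgt_eq, hτ.src_eq]), hτ.tgt_eq]
      natural := fun α => by
        rw [B.assoc, hτ.natural, ← B.assoc, hσ.natural, B.assoc]
        · rw [f.tgt_arr, hσ.src_eq]
        · rw [hσ.tgt_eq, hτ.src_eq]
        · rw [hσ.tgt_eq, g.src_arr]
        · rw [g.tgt_arr, hτ.src_eq]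
        · rw [hσ.tgt_eq, hτ.src_eq]
        · rw [hτ.tgt_eq, k.src_arr] }
  smooth := B.smooth_mul.comp_contMDiff (hσ.smooth.prodMk hτ.smooth) fun a => by
    change B.tgt (σ a) = B.src (τ a)
    rw [hσ.tgt_eq, hτ.src_eq]

theorem comp_left {k : SMor B C} (hσ : IsSmoothNatTrans f g σ) :
    IsSmoothNatTrans (k.comp f) (k.comp g) fun a => k.arr (σ a) where
  isNatTrans :=
    { src_eq := fun a => (k.src_arr _).trans (congrArg k.obj (hσ.src_eq a))
      tgt_eq := fun a => (k.tgt_arr _).trans (congrArg k.obj (hσ.tgt_eq a))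
      natural := fun α => by
        have h := congrArg k.arr (hσ.natural α)
        rw [k.arr_mul _ _ (by rw [hσ.tgt_eq, g.src_arr]),
          k.arr_mul _ _ (by rw [hσ.src_eq, f.tgt_arr])] at h
        exact h }
  smooth := k.smooth_arr.comp hσ.smooth

theorem comp_right {k : SMor C A} (hσ : IsSmoothNatTrans f g σ) :
    IsSmoothNatTrans (f.comp k) (g.comp k) fun a => σ (k.obj a) where
  isNatTrans :=
    { src_eq := fun a => hσ.src_eq (k.obj a)
      tgt_eq := fun a => hσ.tgt_eq (k.obj a)
      natural := fun α => by
        have h := hσ.natural (k.arr α)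
        rwa [k.src_arr, k.tgt_arr] at h }
  smooth := hσ.smooth.comp k.smooth_obj

end IsSmoothNatTrans

end SMor

namespace GenMor

variable {H A B C : LieGroupoid.{u}}

theorem lift_eq (o : GenMor H A) (p : o.fiberObj o) {g : o.U.Arr} (hs : o.U.src g = p.1.1)
    (ht : o.U.tgt g = p.1.2.2) (h : o.ψ.arr g = p.1.2.1) : o.lift p = g :=
  o.equivalence.eq_of_arr_eq ((o.src_lift p).trans hs.symm) ((o.tgt_lift p).trans ht.symm)
    ((o.arr_lift p).trans h.symm)

theorem one_mem_fiberObj (o : GenMor H A) (a : o.U.Obj) :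
    (a, H.one (o.ψ.obj a), a) ∈ o.fiberObj o :=
  ⟨H.src_one _, H.tgt_one _⟩

theorem lift_one (o : GenMor H A) (a : o.U.Obj) : o.lift ⟨_, o.one_mem_fiberObj a⟩ = o.U.one a :=
  o.lift_eq _ (o.U.src_one a) (o.U.tgt_one a) (o.ψ.arr_one a)

/-- The arrow `f ∘ u → g ∘ u` of `Mor(H, B)` induced by a natural transformation `σ : f ⇒ g`:
it sends `(a₁, h, a₂)` to `f(u(l)) · σ(u(a₂))`, where `l : a₁ → a₂` lifts `h`. -/
noncomputable def whisker {f g : SMor A B} {σ : A.Obj → B.Arr} (hσ : f.IsSmoothNatTrans g σ)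
    (o : GenMor H A) : Hom (o.postcomp f) (o.postcomp g) where
  toFun := fun p : o.fiberObj o =>
    B.mul (f.arr (o.map.arr (o.lift p))) (σ (o.map.obj p.1.2.2))
  smooth := fun p : o.fiberObj o => by
    obtain ⟨F, hF, hs⟩ := o.lift_smooth p
    refine ⟨fun q => B.mul (f.arr (o.map.arr (F q))) (σ (o.map.obj q.2.2)), ?_, ?_⟩
    · intro q
      exact congrArg (fun x => B.mul (f.arr (o.map.arr x)) _) (hF q)
    have key : ∀ q ∈ o.fiberObj o,
        B.tgt (f.arr (o.map.arr (F q))) = B.src (σ (o.map.obj q.2.2)) := by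
      intro q hq
      rw [hF ⟨q, hq⟩, f.tgt_arr, o.map.tgt_arr, o.tgt_lift, hσ.src_eq]
    refine ContMDiffWithinAt.comp p.1 (g := fun r : B.Arr × B.Arr => B.mul r.1 r.2)
      (f := fun q : o.U.Obj × H.Arr × o.U.Obj =>
        (f.arr (o.map.arr (F q)), σ (o.map.obj q.2.2)))
      (t := {r : B.Arr × B.Arr | B.tgt r.1 = B.src r.2}) (B.smooth_mul _ (key _ p.2)) ?_ key
    refine ContMDiffWithinAt.prodMk ?_ ?_
    · exact ContMDiffAt.comp_contMDiffWithinAt p.1 (g := fun x => f.arr (o.map.arr x)) (f := F)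
        ((f.smooth_arr.comp o.map.smooth_arr) _) hs
    · exact ((hσ.smooth.comp o.map.smooth_obj).comp
        (contMDiff_snd.comp contMDiff_snd) _).contMDiffWithinAt
  src_eq := fun p : o.fiberObj o => by
    rw [B.src_mul (by rw [f.tgt_arr, o.map.tgt_arr, o.tgt_lift, hσ.src_eq]), f.src_arr,
      o.map.src_arr, o.src_lift]
    rfl
  tgt_eq := fun p : o.fiberObj o => by
    rw [B.tgt_mul (by rw [f.tgt_arr, o.map.tgt_arr, o.tgt_lift, hσ.src_eq]), hσ.tgt_eq]
    rfl
  natural := fun (p q : o.fiberObj o) (g₁ g₂ : o.U.Arr) hs₁ ht₁ hs₂ ht₂ h => by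
    have n : B.mul (f.arr (o.map.arr (o.lift p))) (f.arr (o.map.arr g₂)) =
        B.mul (f.arr (o.map.arr g₁)) (f.arr (o.map.arr (o.lift q))) :=
      ((Hom.id o).postcomp f).natural p q g₁ g₂ hs₁ ht₁ hs₂ ht₂ h
    have nσ := hσ.natural (o.map.arr g₂)
    rw [o.map.src_arr, o.map.tgt_arr, hs₂, ht₂] at nσ
    change B.mul (B.mul _ (σ (o.map.obj p.1.2.2))) (g.arr (o.map.arr g₂)) =
      B.mul (f.arr (o.map.arr g₁)) (B.mul _ (σ (o.map.obj q.1.2.2)))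
    rw [B.assoc, nσ, ← B.assoc, n, B.assoc]
    · rw [f.tgt_arr, f.src_arr, o.map.tgt_arr, o.map.src_arr, o.src_lift, ht₁]
    · rw [f.tgt_arr, o.map.tgt_arr, o.tgt_lift, hσ.src_eq]
    · rw [f.tgt_arr, f.src_arr, o.map.tgt_arr, o.map.src_arr, o.tgt_lift, hs₂]
    · rw [f.tgt_arr, o.map.tgt_arr, hσ.src_eq, ht₂]
    · rw [f.tgt_arr, o.map.tgt_arr, o.tgt_lift, hσ.src_eq]
    · rw [hσ.tgt_eq, g.src_arr, o.map.src_arr, hs₂]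

/-- Naturality of `σ` at `u(l)`, where `l` is the lift, moves `σ` to the left of it. -/
theorem whisker_apply_eq {f g : SMor A B} {σ : A.Obj → B.Arr} (hσ : f.IsSmoothNatTrans g σ)
    (o : GenMor H A) (p : o.fiberObj o) :
    (o.whisker hσ).toFun p =
      B.mul (σ (o.map.obj p.1.1)) (g.arr (o.map.arr (o.lift p))) := by
  have n := hσ.natural (o.map.arr (o.lift p))
  rw [o.map.src_arr, o.map.tgt_arr, o.src_lift, o.tgt_lift] at n
  exact n.symm

/-- The value of `whisker` at `(a, 1, a)`. -/
theorem whisker_one {f g : SMor A B} {σ : A.Obj → B.Arr} (hσ : f.IsSmoothNatTrans g σ)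
    (o : GenMor H A) (a : o.U.Obj) :
    (o.whisker hσ).toFun ⟨_, o.one_mem_fiberObj a⟩ = σ (o.map.obj a) := by
  refine (o.whisker_apply_eq hσ ⟨_, o.one_mem_fiberObj a⟩).trans ?_
  rw [o.lift_one, o.map.arr_one, g.arr_one, B.mul_one (hσ.tgt_eq _)]

theorem whisker_comp_whisker {f g k : SMor A B} {σ τ : A.Obj → B.Arr}
    (hσ : f.IsSmoothNatTrans g σ) (hτ : g.IsSmoothNatTrans k τ) (o : GenMor H A) :
    (o.whisker hσ).comp (o.whisker hτ) = o.whisker (hσ.vcomp hτ) := by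
  refine Hom.ext (funext fun p : o.fiberObj o => ?_)
  refine (compFun_eq (o.whisker hσ) (o.whisker hτ) p.2 (o.one_mem_fiberObj p.1.2.2) rfl p rfl
    (H.mul_one p.2.2).symm rfl).trans ?_
  refine (congrArg (B.mul _) (o.whisker_one hτ _)).trans ?_
  refine B.assoc (g := f.arr (o.map.arr (o.lift p))) ?_ ?_
  · rw [f.tgt_arr, o.map.tgt_arr, o.tgt_lift, hσ.src_eq]
  · rw [hσ.tgt_eq, hτ.src_eq]

theorem whisker_postcomp {f g : SMor A B} {σ : A.Obj → B.Arr} (hσ : f.IsSmoothNatTrans g σ)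
    (k : SMor B C) (o : GenMor H A) :
    (o.whisker hσ).postcomp k = o.whisker (hσ.comp_left (k := k)) := by
  refine Hom.ext (funext fun p : o.fiberObj o => ?_)
  refine k.arr_mul (f.arr (o.map.arr (o.lift p))) (σ (o.map.obj p.1.2.2)) ?_
  rw [f.tgt_arr, o.map.tgt_arr, o.tgt_lift, hσ.src_eq]

theorem whisker_natural {f g : SMor A B} {σ : A.Obj → B.Arr} (hσ : f.IsSmoothNatTrans g σ)
    {x y : GenMor H A} (α : x.Hom y) :
    (x.whisker hσ).comp (α.postcomp g) = (α.postcomp f).comp (y.whisker hσ) := by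
  refine Hom.ext (funext fun p : x.fiberObj y => ?_)
  refine (compFun_eq (x.whisker hσ) (α.postcomp g) (x.one_mem_fiberObj p.1.1) p.2 rfl p rfl
    (H.one_mul p.2.1).symm rfl).trans ?_
  refine Eq.trans ?_ (compFun_eq (α.postcomp f) (y.whisker hσ) p.2
    (y.one_mem_fiberObj p.1.2.2) rfl p rfl (H.mul_one p.2.2).symm rfl).symm
  refine (congrArg (fun b => B.mul b _) (x.whisker_one hσ _)).trans ?_
  refine Eq.trans ?_ (congrArg (B.mul _) (y.whisker_one hσ _)).symm
  have n := hσ.natural (α.toFun p)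
  rwa [α.src_eq, α.tgt_eq] at n

theorem postcomp_comp (f : SMor A B) {x y z : GenMor H A} (α : x.Hom y) (β : y.Hom z) :
    (α.comp β).postcomp f = (α.postcomp f).comp (β.postcomp f) := by
  refine Hom.ext (funext fun p : x.fiberObj z => ?_)
  exact f.arr_mul _ _ (by rw [α.tgt_eq, β.src_eq])

end GenMor

namespace Mor

variable {H A B C : LieGroupoid.{u}}

/-- The functor `Mor(H, A) → Mor(H, B)` given by composition with `f : A → B`. -/
noncomputable def postcomp (H : LieGroupoid.{u}) (f : SMor A B) : Gpd.Hom (Mor H A) (Mor H B) where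
  obj := fun x : GenMor H A => x.postcomp f
  arr := fun α : MorArr H A => ⟨α.src.postcomp f, α.tgt.postcomp f, α.hom.postcomp f⟩
  src_arr _ := rfl
  tgt_arr _ := rfl
  arr_one _ := rfl
  arr_mul := by
    rintro ⟨x, y, α⟩ ⟨y', z, β⟩ h
    obtain rfl : y = y' := h
    refine Eq.trans ?_ (MorArr.mul_mk (α.postcomp f) (β.postcomp f)).symm
    rw [← GenMor.postcomp_comp]
    exact congrArg (fun γ : MorArr H A => (⟨γ.src.postcomp f, γ.tgt.postcomp f,
      γ.hom.postcomp f⟩ : MorArr H B)) (MorArr.mul_mk α β)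

theorem postcomp_comp (g : SMor B C) (f : SMor A B) :
    postcomp H (g.comp f) = (postcomp H g).comp (postcomp H f) := rfl

theorem postcomp_id : postcomp H (SMor.id A) = Gpd.Hom.id (Mor H A) := rfl

/-- The automorphism of `Mor(H, A)` given by composition with an automorphism of `A`. -/
noncomputable def postcompAut (H : LieGroupoid.{u}) (φ : A.SAut) : (Mor H A).Aut where
  hom := postcomp H φ.hom
  inv := postcomp H φ.inv
  hom_inv := by
    rw [← postcomp_comp, ← postcomp_id]
    exact congrArg (postcomp H) (SMor.ext_toHom φ.hom_inv)
  inv_hom := by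
    rw [← postcomp_comp, ← postcomp_id]
    exact congrArg (postcomp H) (SMor.ext_toHom φ.inv_hom)

/-- `GenMor.whisker` as an element of the set of arrows of `Mor(H, B)`. -/
noncomputable def whisker {f g : SMor A B} {σ : A.Obj → B.Arr} (hσ : f.IsSmoothNatTrans g σ)
    (o : (Mor H A).Obj) : (Mor H B).Arr :=
  (⟨_, _, GenMor.whisker hσ o⟩ : MorArr H B)

theorem whisker_congr {f f' g g' : SMor A B} {σ σ' : A.Obj → B.Arr}
    (hσ : f.IsSmoothNatTrans g σ) (hσ' : f'.IsSmoothNatTrans g' σ') (hf : f = f') (hg : g = g')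
    (h : σ = σ') (o : (Mor H A).Obj) : whisker hσ o = whisker hσ' o := by
  subst hf hg h
  rfl

theorem whisker_mul_whisker {f g k : SMor A B} {σ τ : A.Obj → B.Arr}
    (hσ : f.IsSmoothNatTrans g σ) (hτ : g.IsSmoothNatTrans k τ) (o : (Mor H A).Obj) :
    (Mor H B).mul (whisker hσ o) (whisker hτ o) = whisker (hσ.vcomp hτ) o := by
  refine (MorArr.mul_mk _ _).trans ?_
  exact congrArg (fun α => (⟨_, _, α⟩ : MorArr H B)) (GenMor.whisker_comp_whisker hσ hτ o)

theorem postcomp_whisker {f g : SMor A B} {σ : A.Obj → B.Arr} (hσ : f.IsSmoothNatTrans g σ)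
    (k : SMor B C) (o : (Mor H A).Obj) :
    (postcomp H k).arr (whisker hσ o) = whisker (hσ.comp_left (k := k)) o :=
  congrArg (fun α => (⟨_, _, α⟩ : MorArr H C)) (GenMor.whisker_postcomp hσ k o)

theorem isNatTrans_whisker {f g : SMor A B} {σ : A.Obj → B.Arr}
    (hσ : f.IsSmoothNatTrans g σ) :
    Gpd.IsNatTrans (postcomp H f) (postcomp H g) (whisker hσ) where
  src_eq _ := rfl
  tgt_eq _ := rfl
  natural := by
    rintro ⟨x, y, α⟩
    refine (MorArr.mul_mk (x.whisker hσ) (α.postcomp g)).trans ?_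
    refine Eq.trans ?_ (MorArr.mul_mk (α.postcomp f) (y.whisker hσ)).symm
    rw [GenMor.whisker_natural]

/-- Transformations with unit values induce unit arrows. -/
theorem whisker_eq_one {g : SMor A A} {σ : A.Obj → A.Arr}
    (hσ : (SMor.id A).IsSmoothNatTrans g σ) (h : ∀ a, σ a = A.one a) (o : GenMor H A) :
    whisker hσ o = (Mor H A).one o := by
  obtain rfl : σ = A.one := funext h
  obtain rfl : g = SMor.id A := by
    refine SMor.ext_toHom (Gpd.Hom.ext (funext fun a => ?_) (funext fun α => ?_))
    · exact (hσ.tgt_eq a).symm.trans (A.tgt_one a)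
    · have n := hσ.natural α
      rw [A.one_mul ((g.src_arr α).trans ((hσ.tgt_eq _).symm.trans (A.tgt_one _)))] at n
      exact n.trans (A.mul_one rfl)
  refine congrArg (fun α => (⟨_, _, α⟩ : MorArr H A)) ?_
  refine GenMor.Hom.ext (funext fun p : o.fiberObj o => ?_)
  refine A.mul_one (g := o.map.arr (o.lift p)) ?_
  rw [o.map.tgt_arr, o.tgt_lift]

end Mor

/-! ### The induced generalized cocycle with values in the morphism groupoid -/

namespace LieGroupoid.SAut

variable {A : LieGroupoid.{u}} (φ : A.SAut)

theorem hom_inv_obj (a : A.Obj) : φ.hom.obj (φ.inv.obj a) = a := φ.toAut.hom_inv_obj a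

theorem hom_inv_arr (α : A.Arr) : φ.hom.arr (φ.inv.arr α) = α := φ.toAut.hom_inv_arr α

end LieGroupoid.SAut

namespace IsLieGenCocycle

variable {A K : LieGroupoid.{u}} {Λ : K.Arr → A.SAut} {Ω : K.Arr → K.Arr → A.Obj → A.Arr}

theorem isSmoothNatTrans_Ω (h : IsLieGenCocycle A K Λ Ω) {ξ η : K.Arr} (e : K.tgt ξ = K.src η) :
    (SMor.id A).IsSmoothNatTrans ((Λ (K.mul ξ η)).inv.comp ((Λ η).hom.comp (Λ ξ).hom)) (Ω ξ η) where
  isNatTrans := h.isGenCocycle.natTrans ξ η e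
  smooth := h.smooth_Ω.comp_contMDiff (f := fun a : A.Obj => ((ξ, η), a))
    (contMDiff_const.prodMk contMDiff_id) fun _ => e

open Classical in
/-- The cofactor with values in `Mor(H, A)` induced by `Ω`. Its values at pairs that are not
composable are irrelevant; units are used there. -/
noncomputable def morΩ (h : IsLieGenCocycle A K Λ Ω) (H : LieGroupoid.{u}) (ξ η : K.Arr)
    (o : (Mor H A).Obj) : (Mor H A).Arr :=
  if e : K.tgt ξ = K.src η then Mor.whisker (h.isSmoothNatTrans_Ω e) o else (Mor H A).one o

theorem morΩ_eq (h : IsLieGenCocycle A K Λ Ω) (H : LieGroupoid.{u}) {ξ η : K.Arr}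
    (e : K.tgt ξ = K.src η) : h.morΩ H ξ η = Mor.whisker (h.isSmoothNatTrans_Ω e) :=
  funext fun _ => dif_pos e

theorem isGenCocycle_mor (h : IsLieGenCocycle A K Λ Ω) (H : LieGroupoid.{u}) :
    IsGenCocycle (Mor H A) K.toGpd (fun ξ => Mor.postcompAut H (Λ ξ)) (h.morΩ H) where
  aut_one x := by
    have e : (Λ (K.one x)).hom = SMor.id A := SMor.ext_toHom (h.isGenCocycle.aut_one x)
    exact congrArg (Mor.postcomp H) e
  natTrans ξ η e := by
    rw [h.morΩ_eq H e]
    exact Mor.isNatTrans_whisker (h.isSmoothNatTrans_Ω e)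
  one_left η o := by
    rw [h.morΩ_eq H (K.tgt_one _)]
    exact Mor.whisker_eq_one _ (h.isGenCocycle.one_left η) o
  one_right ξ o := by
    rw [h.morΩ_eq H (K.src_one _).symm]
    exact Mor.whisker_eq_one _ (h.isGenCocycle.one_right ξ) o
  cocycle ξ η ζ e e' o := by
    have e₁ : K.tgt (K.mul ξ η) = K.src ζ := (K.tgt_mul e).trans e'
    have e₂ : K.tgt ξ = K.src (K.mul η ζ) := e.trans (K.src_mul e').symm
    rw [h.morΩ_eq H e, h.morΩ_eq H e₁, h.morΩ_eq H e', h.morΩ_eq H e₂]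
    let s : SMor A A := (Λ (K.mul ξ η)).inv.comp ((Λ η).hom.comp (Λ ξ).hom)
    let m : SMor A A := (Λ ξ).inv.comp
      ((Λ (K.mul η ζ)).inv.comp ((Λ ζ).hom.comp ((Λ η).hom.comp (Λ ξ).hom)))
    have hl := (h.isSmoothNatTrans_Ω e₁).comp_right (k := s)
    have hr := ((h.isSmoothNatTrans_Ω e').comp_right (k := (Λ ξ).hom)).comp_left
      (k := (Λ ξ).inv)
    have hr' := (h.isSmoothNatTrans_Ω e₂).comp_right (k := m)
    -- both sides are induced by vertical composites of transformations between endomorphisms of `A`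
    refine (Mor.whisker_mul_whisker (h.isSmoothNatTrans_Ω e) hl o).trans ?_
    refine Eq.trans ?_ (congrArg (fun α => (Mor H A).mul α (Mor.whisker hr' o))
      (Mor.postcomp_whisker ((h.isSmoothNatTrans_Ω e').comp_right (k := (Λ ξ).hom))
        (Λ ξ).inv o).symm)
    refine Eq.trans ?_ (Mor.whisker_mul_whisker hr hr' o).symm
    refine Mor.whisker_congr _ _ ?_ ?_ (funext fun a => h.isGenCocycle.cocycle ξ η ζ e e' a) o
    · exact (SMor.ext_toHom (Λ ξ).inv_hom).symm
    · have hK := K.assoc e e'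
      refine SMor.ext_toHom (Gpd.Hom.ext (funext fun a => ?_) (funext fun α => ?_))
      · change (Λ (K.mul (K.mul ξ η) ζ)).inv.obj ((Λ ζ).hom.obj ((Λ (K.mul ξ η)).hom.obj
          ((Λ (K.mul ξ η)).inv.obj ((Λ η).hom.obj ((Λ ξ).hom.obj a))))) =
          (Λ (K.mul ξ (K.mul η ζ))).inv.obj ((Λ (K.mul η ζ)).hom.obj ((Λ ξ).hom.obj
            ((Λ ξ).inv.obj ((Λ (K.mul η ζ)).inv.obj
              ((Λ ζ).hom.obj ((Λ η).hom.obj ((Λ ξ).hom.obj a)))))))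
        simp only [LieGroupoid.SAut.hom_inv_obj, hK]
      · change (Λ (K.mul (K.mul ξ η) ζ)).inv.arr ((Λ ζ).hom.arr ((Λ (K.mul ξ η)).hom.arr
          ((Λ (K.mul ξ η)).inv.arr ((Λ η).hom.arr ((Λ ξ).hom.arr α))))) =
          (Λ (K.mul ξ (K.mul η ζ))).inv.arr ((Λ (K.mul η ζ)).hom.arr ((Λ ξ).hom.arr
            ((Λ ξ).inv.arr ((Λ (K.mul η ζ)).inv.arr
              ((Λ ζ).hom.arr ((Λ η).hom.arr ((Λ ξ).hom.arr α)))))))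
        simp only [LieGroupoid.SAut.hom_inv_arr, hK]

end IsLieGenCocycle

theorem theoremT (H A K : LieGroupoid.{u}) (Λ : K.Arr → A.SAut)
    (Ω : K.Arr → K.Arr → A.Obj → A.Arr) (hΛΩ : IsLieGenCocycle A K Λ Ω) :
    (∃ (Λt : K.Arr → (Mor H A).Aut)
      (Ωt : K.Arr → K.Arr → (Mor H A).Obj → (Mor H A).Arr),
      -- the formulas for the induced pair
      (∀ (ξ : K.Arr) (o : GenMor H A), (Λt ξ).hom.obj o = o.postcomp (Λ ξ).hom) ∧
      (∀ (ξ : K.Arr) (α : MorArr H A), (Λt ξ).hom.arr α =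
        ⟨α.src.postcomp (Λ ξ).hom, α.tgt.postcomp (Λ ξ).hom, α.hom.postcomp (Λ ξ).hom⟩) ∧
      (∀ ξ η : K.Arr, K.tgt ξ = K.src η → ∀ o : GenMor H A,
        ∃ τ : o.Hom (o.postcomp ((Λ (K.mul ξ η)).inv.comp ((Λ η).hom.comp (Λ ξ).hom))),
          Ωt ξ η o = ⟨o, _, τ⟩ ∧
          ∀ (p : o.fiberObj o) (g : o.U.Arr),
            o.U.src g = p.1.1 → o.U.tgt g = p.1.2.2 → o.ψ.arr g = p.1.2.1 →
            τ.toFun p = A.mul (o.map.arr g) (Ω ξ η (o.map.obj p.1.2.2)) ∧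
            τ.toFun p = A.mul (Ω ξ η (o.map.obj p.1.1))
              ((Λ (K.mul ξ η)).inv.arr ((Λ η).hom.arr ((Λ ξ).hom.arr (o.map.arr g))))) ∧
      -- it is a generalized cocycle and defines an extension
      IsGenCocycle (Mor H A) K.toGpd Λt Ωt ∧
      IsProductExtension (Mor H A) K.toGpd Λt Ωt (semidirect (Mor H A) K.toGpd Λt Ωt) ∧
      -- restriction to the generalized morphisms of class `β`
      ∀ (n : ℕ) (fund : Homology n H.str.Coarse) (β : Homology n hΛΩ.coarse),
        hΛΩ.FiberIndependent β →
        (∀ (ξ : K.Arr) (o : (Mor H A).Obj),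
          (Λt ξ).hom.obj o ∈ morClass hΛΩ fund β ↔ o ∈ morClass hΛΩ fund β) ∧
        ∃ (Λβ : K.Arr → ((Mor H A).restrict (morClass hΛΩ fund β)).Aut)
          (Ωβ : K.Arr → K.Arr → ((Mor H A).restrict (morClass hΛΩ fund β)).Obj →
            ((Mor H A).restrict (morClass hΛΩ fund β)).Arr),
          (∀ ξ o, ((Λβ ξ).hom.obj o).1 = (Λt ξ).hom.obj o.1) ∧
          (∀ ξ α, ((Λβ ξ).hom.arr α).1 = (Λt ξ).hom.arr α.1) ∧
          (∀ ξ η, K.tgt ξ = K.src η → ∀ o, (Ωβ ξ η o).1 = Ωt ξ η o.1) ∧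
          IsGenCocycle ((Mor H A).restrict (morClass hΛΩ fund β)) K.toGpd Λβ Ωβ ∧
          IsProductExtension ((Mor H A).restrict (morClass hΛΩ fund β)) K.toGpd Λβ Ωβ
            (semidirect ((Mor H A).restrict (morClass hΛΩ fund β)) K.toGpd Λβ Ωβ)) ∧
    -- if `K⁰` is connected, the hypothesis on `β` is satisfied
    (PreconnectedSpace K.Obj →
      ∀ (n : ℕ) (β : Homology n hΛΩ.coarse), hΛΩ.FiberIndependent β) := by
  have hM := hΛΩ.isGenCocycle_mor H
  refine ⟨⟨_, _, fun _ _ => rfl, fun _ _ => rfl, ?_, hM, hM.isProductExtension_semidirect,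
    ?_⟩, fun _ _ β => hΛΩ.fiberIndependent_of_preconnectedSpace β⟩
  · intro ξ η e o
    refine ⟨o.whisker (hΛΩ.isSmoothNatTrans_Ω e), congrFun (hΛΩ.morΩ_eq H e) o, ?_⟩
    intro p g hs ht hg
    obtain rfl := o.lift_eq p hs ht hg
    exact ⟨rfl, o.whisker_apply_eq (hΛΩ.isSmoothNatTrans_Ω e) p⟩
  · intro n fund β hβ
    have hP : ∀ (ξ : K.Arr) (o : (Mor H A).Obj),
        (Mor.postcompAut H (Λ ξ)).hom.obj o ∈ morClass hΛΩ fund β ↔ o ∈ morClass hΛΩ fund β :=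
      postcomp_mem_morClass_iff hΛΩ fund hβ
    have hR := hM.restrict (morClass hΛΩ fund β) hP
    exact ⟨hP, _, _, fun _ _ => rfl, fun _ _ => rfl, fun _ _ e => hM.restrictΩ_val _ hP e, hR,
      hR.isProductExtension_semidirect⟩
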